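/- Let $(M^2,\bar g)$ and $(N^3,h)$ be smooth Riemannian manifolds (without boundary) of dimensions $2$ and $3$, let $\varphi:M\to N$ be a smooth immersion, and let $\lambda:M\to\mathbb R$ be a function with $\varphi^*h=\lambda^2\bar g$ (so $\lambda^2$ is smooth and positive). Put $g=\varphi^*h=\lambda^2\bar g$. For a smooth map $\phi:(M,g)\to(N,h)$ let $\tau(\phi)=\mathrm{Trace}_g\nabla d\phi$ be the tension field and $$\tau_2(\phi)=\mathrm{Trace}_g\big(\nabla^\phi\nabla^\phi-\nabla^\phi_{\nabla^M}\big)\tau(\phi)-\mathrm{Trace}_g\,R^N(d\phi,\tau(\phi))\,d\phi ,\qquad R^N(X,Y)Z=[\nabla^N_X,\nabla^N_Y]Z-\nabla^N_{[X,Y]}Z,$$ the bitension field. The map $\phi$ is called biharmonic if it solves the biharmonic map equation $\tau_2(\phi)=0$ and, for a positive function $f$ on $M$, $f$-biharmonic if it solves the $f$-biharmonic map equation $f\,\tau_2(\phi)+(\Delta f)\,\tau(\phi)+2\nabla^\phi_{\mathrm{grad} f}\tau(\phi)=0$ (the Euler–Lagrange equations of the bienergy $\frac12\int|\tau(\phi)|^2v_g$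 and of the $f$-bienergy $\frac12\int f|\tau(\phi)|^2v_g$). Then $\varphi:(M,\bar g)\to(N,h)$ is biharmonic if and only if the surface, i.e. the isometric immersion $\varphi:(M,g)\to(N,h)$, is $f$-biharmonic with $f=\lambda^2$. Moreover, this holds if and only if, for every smooth unit normal vector field $\xi$ of $\varphi$ over an open subset of $M$, one has on this subset $$\begin{cases}\Delta(\lambda^2H)-\lambda^2H\,\big(|A|^2-\mathrm{Ric}^N(\xi,\xi)\big)=0,\\[2pt] A(\mathrm{grad}(\lambda^2H))+\lambda^2H\,\big(\mathrm{grad}\,H-(\mathrm{Ric}^N\xi)^\top\big)=0;\end{cases}$$ and if there is a global smooth unit normal vector field $\xi$ on $M$, it holds if and only if this system is satisfied on $M$ for that $\xi$. Here $A$ is the shape operator, $g(AX,Y)=-h(\nabla^\varphi_X\xi,d\varphi(Y))$, $H=\frac12\,\mathrm{trace}\,A$ is the mean curvature function, $\mathrm{Ric}^N$ is the Ricci tensor of $(N,h)$ (and its Ricci operator), $(\cdot)^\top$ is the tangential part, and $\Delta$, $\mathrm{grad}$ and $|\cdot|$ are taken with respect to the induced metric $g$. -/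

import Mathlib

open scoped Manifold ContDiff

noncomputable section

namespace BiharmonicSurface

/-- Coordinate space `ℝⁿ`. -/
abbrev Coord (n : ℕ) : Type := EuclideanSpace ℝ (Fin n)

/-! ### Local Riemannian geometry in coordinates

`G : Coord m → Matrix` is the matrix `(g_ij)` of a metric in a chart of the source, `K` is the matrix
`(h_ab)` of a metric in a chart of the target, and `F : Coord m → Coord n` is a map read in these
charts. Vector fields along `F` are given by their components `V x a`. -/

/-- The partial derivative `∂_i u` at `x`. -/
def pd {m : ℕ} (i : Fin m) (u : Coord m → ℝ) (x : Coord m) : ℝ :=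
  fderiv ℝ u x (EuclideanSpace.single i 1)

/-- The Christoffel symbol `Γ^k_ij = ½ g^{kl} (∂_i g_jl + ∂_j g_il - ∂_l g_ij)` of the Levi-Civita
connection of `G` at `x`. -/
def christoffel {m : ℕ} (G : Coord m → Matrix (Fin m) (Fin m) ℝ) (x : Coord m) (k i j : Fin m) : ℝ :=
  1 / 2 * ∑ l, (G x)⁻¹ k l *
    (pd i (fun y => G y j l) x + pd j (fun y => G y i l) x - pd l (fun y => G y i j) x)

/-- The components of the curvature operator `R(X,Y)Z = [∇_X,∇_Y]Z - ∇_[X,Y] Z`: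
`R(∂_i,∂_j)∂_k = ∑ l, riemann G x l k i j • ∂_l`. -/
def riemann {m : ℕ} (G : Coord m → Matrix (Fin m) (Fin m) ℝ) (x : Coord m) (l k i j : Fin m) : ℝ :=
  pd i (fun y => christoffel G y l j k) x - pd j (fun y => christoffel G y l i k) x
    + ∑ s, (christoffel G x l i s * christoffel G x s j k
      - christoffel G x l j s * christoffel G x s i k)

/-- The Ricci curvature `Ric(∂_j,∂_k) = trace (X ↦ R(X,∂_j)∂_k)` (positive on round spheres). -/
def ricci {m : ℕ} (G : Coord m → Matrix (Fin m) (Fin m) ℝ) (x : Coord m) (j k : Fin m) : ℝ :=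
  ∑ i, riemann G x i k i j

/-- The components `g^{kl} ∂_l u` of the gradient of a function. -/
def grad {m : ℕ} (G : Coord m → Matrix (Fin m) (Fin m) ℝ) (u : Coord m → ℝ) (x : Coord m)
    (k : Fin m) : ℝ :=
  ∑ l, (G x)⁻¹ k l * pd l u x

/-- The Laplace-Beltrami operator `Δu = g^{ij} (∂_i ∂_j u - Γ^k_ij ∂_k u)` on functions. -/
def laplacian {m : ℕ} (G : Coord m → Matrix (Fin m) (Fin m) ℝ) (u : Coord m → ℝ)
    (x : Coord m) : ℝ :=
  ∑ i, ∑ j, (G x)⁻¹ i j * (pd i (pd j u) x - ∑ k, christoffel G x k i j * pd k u x)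

/-- The components `∂_j F^a` of the vector field `dF(∂_j)` along `F`. -/
def dMap {m n : ℕ} (F : Coord m → Coord n) (j : Fin m) (x : Coord m) (a : Fin n) : ℝ :=
  pd j (fun y => F y a) x

/-- The pull-back connection `∇^F`: the components
`(∇^F_{∂_i} V)^a = ∂_i V^a + Γ^a_bc(F) ∂_i F^b V^c`, for a vector field `V` along `F`. -/
def covAlong {m n : ℕ} (K : Coord n → Matrix (Fin n) (Fin n) ℝ) (F : Coord m → Coord n)
    (V : Coord m → Fin n → ℝ) (i : Fin m) (x : Coord m) (a : Fin n) : ℝ :=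
  pd i (fun y => V y a) x + ∑ b, ∑ c, christoffel K (F x) a b c * dMap F i x b * V x c

/-- The tension field `τ(F) = Trace_g ∇dF = g^{ij} (∇^F_{∂_i} dF(∂_j) - Γ^k_ij dF(∂_k))`. -/
def tension {m n : ℕ} (G : Coord m → Matrix (Fin m) (Fin m) ℝ)
    (K : Coord n → Matrix (Fin n) (Fin n) ℝ) (F : Coord m → Coord n) (x : Coord m)
    (a : Fin n) : ℝ :=
  ∑ i, ∑ j, (G x)⁻¹ i j *
    (covAlong K F (dMap F j) i x a - ∑ k, christoffel G x k i j * dMap F k x a)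

/-- The rough Laplacian `Trace_g (∇^F ∇^F - ∇^F_{∇^M}) V` on vector fields along `F`. -/
def roughLaplacian {m n : ℕ} (G : Coord m → Matrix (Fin m) (Fin m) ℝ)
    (K : Coord n → Matrix (Fin n) (Fin n) ℝ) (F : Coord m → Coord n)
    (V : Coord m → Fin n → ℝ) (x : Coord m) (a : Fin n) : ℝ :=
  ∑ i, ∑ j, (G x)⁻¹ i j *
    (covAlong K F (covAlong K F V j) i x a - ∑ k, christoffel G x k i j * covAlong K F V k x a)

/-- The bitension field
`τ₂(F) = Trace_g (∇^F ∇^F - ∇^F_{∇^M}) τ(F) - Trace_g R^N(dF, τ(F)) dF`. -/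
def bitension {m n : ℕ} (G : Coord m → Matrix (Fin m) (Fin m) ℝ)
    (K : Coord n → Matrix (Fin n) (Fin n) ℝ) (F : Coord m → Coord n) (x : Coord m)
    (a : Fin n) : ℝ :=
  roughLaplacian G K F (tension G K F) x a
    - ∑ i, ∑ j, (G x)⁻¹ i j * ∑ b, ∑ c, ∑ d,
        riemann K (F x) a b c d * dMap F i x c * tension G K F x d * dMap F j x b

/-- The `f`-bitension field `τ_{2,f}(F) = f τ₂(F) + (Δf) τ(F) + 2 ∇^F_{grad f} τ(F)`. -/
def fBitension {m n : ℕ} (G : Coord m → Matrix (Fin m) (Fin m) ℝ)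
    (K : Coord n → Matrix (Fin n) (Fin n) ℝ) (f : Coord m → ℝ) (F : Coord m → Coord n)
    (x : Coord m) (a : Fin n) : ℝ :=
  f x * bitension G K F x a + laplacian G f x * tension G K F x a
    + 2 * ∑ k, grad G f x k * covAlong K F (tension G K F) k x a

/-- The shape operator of a hypersurface `F` with unit normal field `ν`, i.e. the operator `A` with
`g(A X, Y) = -h(∇^F_X ν, dF(Y))`. Its matrix is given by `A ∂_i = ∑ k, shape G K F ν x k i • ∂_k`. -/
def shape {m n : ℕ} (G : Coord m → Matrix (Fin m) (Fin m) ℝ)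
    (K : Coord n → Matrix (Fin n) (Fin n) ℝ) (F : Coord m → Coord n)
    (ν : Coord m → Fin n → ℝ) (x : Coord m) (k i : Fin m) : ℝ :=
  -∑ j, (G x)⁻¹ k j * ∑ a, ∑ b, K (F x) a b * covAlong K F ν i x a * dMap F j x b

/-- The mean curvature function `H = (1/m) trace A`. -/
def meanCurvature {m n : ℕ} (G : Coord m → Matrix (Fin m) (Fin m) ℝ)
    (K : Coord n → Matrix (Fin n) (Fin n) ℝ) (F : Coord m → Coord n)
    (ν : Coord m → Fin n → ℝ) (x : Coord m) : ℝ :=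
  1 / (m : ℝ) * ∑ i, shape G K F ν x i i

/-- The squared norm `|A|² = g^{ij} g_{kl} A^k_i A^l_j` of the shape operator. -/
def shapeNormSq {m n : ℕ} (G : Coord m → Matrix (Fin m) (Fin m) ℝ)
    (K : Coord n → Matrix (Fin n) (Fin n) ℝ) (F : Coord m → Coord n)
    (ν : Coord m → Fin n → ℝ) (x : Coord m) : ℝ :=
  ∑ i, ∑ j, ∑ k, ∑ l,
    (G x)⁻¹ i j * G x k l * shape G K F ν x k i * shape G K F ν x l j

/-- The function `Ric^N(ν,ν)`. -/
def ricciNormal {m n : ℕ} (K : Coord n → Matrix (Fin n) (Fin n) ℝ) (F : Coord m → Coord n)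
    (ν : Coord m → Fin n → ℝ) (x : Coord m) : ℝ :=
  ∑ a, ∑ b, ricci K (F x) a b * ν x a * ν x b

/-- The tangential part `(Ric^N(ν))^⊤` of the Ricci operator applied to `ν`: the tangent vector `T`
with `g(T, Y) = h(Ric^N(ν), dF(Y)) = Ric^N(ν, dF(Y))`, so `T^k = g^{kl} Ric^N(ν, dF(∂_l))`. -/
def ricciTangent {m n : ℕ} (G : Coord m → Matrix (Fin m) (Fin m) ℝ)
    (K : Coord n → Matrix (Fin n) (Fin n) ℝ) (F : Coord m → Coord n)
    (ν : Coord m → Fin n → ℝ) (x : Coord m) (k : Fin m) : ℝ :=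
  ∑ l, (G x)⁻¹ k l * ∑ a, ∑ b, ricci K (F x) a b * ν x a * dMap F l x b

/-- In coordinates, at `x`, the system
`Δ(f H) - f H (|A|² - Ric^N(ν,ν)) = 0`, `A(grad(f H)) + f H (grad H - (Ric^N(ν))^⊤) = 0`. -/
def SystemAt {m n : ℕ} (G : Coord m → Matrix (Fin m) (Fin m) ℝ)
    (K : Coord n → Matrix (Fin n) (Fin n) ℝ) (f : Coord m → ℝ) (F : Coord m → Coord n)
    (ν : Coord m → Fin n → ℝ) (x : Coord m) : Prop :=
  laplacian G (fun y => f y * meanCurvature G K F ν y) x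
      - f x * meanCurvature G K F ν x * (shapeNormSq G K F ν x - ricciNormal K F ν x) = 0 ∧
  ∀ k, ∑ i, shape G K F ν x k i * grad G (fun y => f y * meanCurvature G K F ν y) x i
      + f x * meanCurvature G K F ν x
        * (grad G (meanCurvature G K F ν) x k - ricciTangent G K F ν x k) = 0

/-! ### Manifolds -/

section Manifolds

variable {m n : ℕ}
variable {M : Type*} [TopologicalSpace M] [ChartedSpace (Coord m) M]
variable {N : Type*} [TopologicalSpace N] [ChartedSpace (Coord n) N]

/-- A field of real-valued forms in two tangent vectors; it is only used for Riemannian metrics. -/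
abbrev MetricField (m : ℕ) (M : Type*) [TopologicalSpace M] [ChartedSpace (Coord m) M] : Type _ :=
  ∀ p : M, TangentSpace (𝓡 m) p → TangentSpace (𝓡 m) p → ℝ

/-- The field of inner products of a smooth Riemannian metric. -/
def metricField [IsManifold (𝓡 m) ∞ M]
    (g : Bundle.ContMDiffRiemannianMetric (𝓡 m) ∞ (Coord m)
      (fun p : M => TangentSpace (𝓡 m) p)) : MetricField m M :=
  fun p v w => g.inner p v w

/-- The pull-back `φ^* h`, i.e. `(φ^* h)_p(v, w) = h_{φ(p)}(dφ_p v, dφ_p w)`. -/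
def pullbackMetric (m : ℕ) {M : Type*} [TopologicalSpace M] [ChartedSpace (Coord m) M]
    (h : MetricField n N) (φ : M → N) : MetricField m M := fun p v w =>
  h (φ p) (mfderiv (𝓡 m) (𝓡 n) φ p v) (mfderiv (𝓡 m) (𝓡 n) φ p w)

/-- The matrix `g_ij = g(∂_i, ∂_j)` of a metric in the chart `e`, as a function of the
coordinates. -/
def metricInChart (g : MetricField m M) (e : OpenPartialHomeomorph M (Coord m)) (x : Coord m) :
    Matrix (Fin m) (Fin m) ℝ := fun i j =>
  g (e.symm x) (mfderiv (𝓡 m) (𝓡 m) e.symm x (EuclideanSpace.single i (1 : ℝ)))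
    (mfderiv (𝓡 m) (𝓡 m) e.symm x (EuclideanSpace.single j (1 : ℝ)))

/-- The map `φ` read in the charts `e` of `M` and `e'` of `N`. -/
def mapInCharts (φ : M → N) (e : OpenPartialHomeomorph M (Coord m))
    (e' : OpenPartialHomeomorph N (Coord n)) : Coord m → Coord n :=
  fun x => e' (φ (e.symm x))

/-- The components, in the chart `e'` of `N`, of a vector field `ξ` along `φ`, as functions of the
coordinates in the chart `e` of `M`. -/
def fieldInCharts (φ : M → N) (ξ : ∀ p : M, TangentSpace (𝓡 n) (φ p))
    (e : OpenPartialHomeomorph M (Coord m)) (e' : OpenPartialHomeomorph N (Coord n))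
    (x : Coord m) (a : Fin n) : ℝ :=
  (show Coord n from mfderiv (𝓡 n) (𝓡 n) e' (φ (e.symm x)) (ξ (e.symm x))) a

/-- A map `φ : (M, g) → (N, h)` is biharmonic if its bitension field vanishes, in all local
coordinates around all points. -/
def IsBiharmonic (g : MetricField m M) (h : MetricField n N) (φ : M → N) : Prop :=
  ∀ e ∈ IsManifold.maximalAtlas (𝓡 m) ∞ M, ∀ e' ∈ IsManifold.maximalAtlas (𝓡 n) ∞ N,
    ∀ p ∈ e.source, φ p ∈ e'.source →
      ∀ a, bitension (metricInChart g e) (metricInChart h e') (mapInCharts φ e e') (e p) a = 0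

/-- A map `φ : (M, g) → (N, h)` is `f`-biharmonic if its `f`-bitension field vanishes, in all local
coordinates around all points. -/
def IsFBiharmonic (g : MetricField m M) (h : MetricField n N) (f : M → ℝ) (φ : M → N) : Prop :=
  ∀ e ∈ IsManifold.maximalAtlas (𝓡 m) ∞ M, ∀ e' ∈ IsManifold.maximalAtlas (𝓡 n) ∞ N,
    ∀ p ∈ e.source, φ p ∈ e'.source →
      ∀ a, fBitension (metricInChart g e) (metricInChart h e') (f ∘ e.symm) (mapInCharts φ e e')
        (e p) a = 0

/-- `ξ` is a smooth unit normal vector field of the immersion `φ` over the set `U`. -/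
structure IsUnitNormalOn (m : ℕ) {M : Type*} [TopologicalSpace M] [ChartedSpace (Coord m) M]
    [IsManifold (𝓡 n) ∞ N] (h : MetricField n N) (φ : M → N)
    (ξ : ∀ p : M, TangentSpace (𝓡 n) (φ p)) (U : Set M) : Prop where
  smooth : ContMDiffOn (𝓡 m) (𝓡 n).tangent ∞
    (fun p => (⟨φ p, ξ p⟩ : TangentBundle (𝓡 n) N)) U
  unit : ∀ p ∈ U, h (φ p) (ξ p) (ξ p) = 1
  normal : ∀ p ∈ U, ∀ v : TangentSpace (𝓡 m) p, h (φ p) (ξ p) (mfderiv (𝓡 m) (𝓡 n) φ p v) = 0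

/-- The system `Δ(f H) - f H (|A|² - Ric^N(ξ,ξ)) = 0`,
`A(grad(f H)) + f H (grad H - (Ric^N(ξ))^⊤) = 0` for the immersion `φ : (M, g) → (N, h)` with unit
normal field `ξ`, over the set `U`; all operators on `M` are those of the metric `g`. -/
def SystemOn (g : MetricField m M) (h : MetricField n N) (f : M → ℝ) (φ : M → N)
    (ξ : ∀ p : M, TangentSpace (𝓡 n) (φ p)) (U : Set M) : Prop :=
  ∀ e ∈ IsManifold.maximalAtlas (𝓡 m) ∞ M, ∀ e' ∈ IsManifold.maximalAtlas (𝓡 n) ∞ N,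
    ∀ p ∈ e.source ∩ U, φ p ∈ e'.source →
      SystemAt (metricInChart g e) (metricInChart h e') (f ∘ e.symm) (mapInCharts φ e e')
        (fieldInCharts φ ξ e e') (e p)

end Manifolds

end BiharmonicSurface

end

noncomputable section

namespace BiharmonicSurface

/-!
Both tension-type fields are values of one operator: with
`J V = Trace_g (∇^φ ∇^φ - ∇^φ_{∇^M}) V - Trace_g R^N(dφ, V) dφ` one has `τ₂(φ) = J τ(φ)`, and the
left-hand side of the `f`-biharmonic equation is `J (f τ(φ))` by the Leibniz rule. In dimension two
the contracted Christoffel symbols `g^{ij} Γ^k_ij` simply scale under a conformal change of the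
metric, so passing from `g = f ḡ` to `ḡ` multiplies both `J` and `τ` by `f`; thus `τ₂` for `ḡ` is
`f J (f τ)`, which vanishes together with `J (f τ)`.

For a surface with unit normal `ξ` one has `τ = 2 H ξ`. Decomposing `J (2 f H ξ)` with the
Weingarten formula, the traced Codazzi equation and the Ricci tensor, its normal part is twice the
left-hand side of the first equation of the system, and its tangential part is `-2` times that of
the second. Since a local unit normal exists near every point, by normalising the normal part of a
constant vector in a chart, this characterises `f`-biharmonicity.
-/

/-! ### Partial derivatives -/

section Calculus

variable {m n : ℕ} {i j : Fin m} {u v : Coord m → ℝ} {x : Coord m} {s : Set (Coord m)}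

theorem differentiableAt_of_contDiffOn {E F : Type*} [NormedAddCommGroup E] [NormedSpace ℝ E]
    [NormedAddCommGroup F] [NormedSpace ℝ F] {f : E → F} {t : Set E} {y : E}
    (hf : ContDiffOn ℝ ∞ f t) (ht : IsOpen t) (hy : y ∈ t) : DifferentiableAt ℝ f y :=
  (hf.contDiffAt (ht.mem_nhds hy)).differentiableAt (by simp)

theorem pd_congr (hs : IsOpen s) (hx : x ∈ s) (h : Set.EqOn u v s) : pd i u x = pd i v x := by
  simp only [pd, (Filter.eventuallyEq_of_mem (hs.mem_nhds hx) h).fderiv_eq]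

theorem pd_const (c : ℝ) : pd i (fun _ => c) x = 0 := by simp [pd]

theorem pd_add (hu : DifferentiableAt ℝ u x) (hv : DifferentiableAt ℝ v x) :
    pd i (fun y => u y + v y) x = pd i u x + pd i v x := by
  simp [pd, fderiv_fun_add hu hv]

theorem pd_mul (hu : DifferentiableAt ℝ u x) (hv : DifferentiableAt ℝ v x) :
    pd i (fun y => u y * v y) x = pd i u x * v x + u x * pd i v x := by
  simp only [pd, fderiv_fun_mul hu hv, add_apply, smul_apply, smul_eq_mul]
  ring

theorem pd_neg : pd i (fun y => -u y) x = -pd i u x := by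
  simp [pd, fderiv_fun_neg]

theorem pd_sum {ι : Type*} {t : Finset ι} {w : ι → Coord m → ℝ}
    (hw : ∀ k ∈ t, DifferentiableAt ℝ (w k) x) :
    pd i (fun y => ∑ k ∈ t, w k y) x = ∑ k ∈ t, pd i (w k) x := by
  simp [pd, fderiv_fun_sum hw]

theorem contDiffOn_pd (hs : IsOpen s) (hu : ContDiffOn ℝ ∞ u s) (i : Fin m) :
    ContDiffOn ℝ ∞ (pd i u) s :=
  (hu.fderiv_of_isOpen hs (by simp)).clm_apply contDiffOn_const

theorem pd_pd_eq_fderiv_fderiv (hs : IsOpen s) (hu : ContDiffOn ℝ ∞ u s) (hx : x ∈ s)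
    (i j : Fin m) : pd i (pd j u) x
      = fderiv ℝ (fderiv ℝ u) x (EuclideanSpace.single i 1) (EuclideanSpace.single j 1) := by
  have hd : DifferentiableAt ℝ (fderiv ℝ u) x :=
    differentiableAt_of_contDiffOn (hu.fderiv_of_isOpen hs (m := ∞) (by simp)) hs hx
  change fderiv ℝ (fun y => fderiv ℝ u y (EuclideanSpace.single j 1)) x _ = _
  rw [fderiv_clm_apply hd (differentiableAt_const _)]
  simp

theorem pd_comm (hs : IsOpen s) (hu : ContDiffOn ℝ ∞ u s) (hx : x ∈ s) :
    pd i (pd j u) x = pd j (pd i u) x := by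
  have hsymm : IsSymmSndFDerivAt ℝ u x :=
    (hu.contDiffAt (hs.mem_nhds hx)).isSymmSndFDerivAt
      (by simpa using (WithTop.coe_le_coe.2 (le_top : (2 : ℕ∞) ≤ ⊤)))
  rw [pd_pd_eq_fderiv_fderiv hs hu hx, pd_pd_eq_fderiv_fderiv hs hu hx, hsymm.eq]

/-- The componentwise partial derivative `∂_i V` of a vector-valued function. -/
def pdVec (i : Fin m) (V : Coord m → Fin n → ℝ) (x : Coord m) : Fin n → ℝ :=
  fun a => pd i (fun y => V y a) x

/-- The entrywise partial derivative `∂_i A` of a matrix-valued function. -/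
def pdMat {k l : ℕ} (i : Fin m) (A : Coord m → Matrix (Fin k) (Fin l) ℝ) (x : Coord m) :
    Matrix (Fin k) (Fin l) ℝ :=
  Matrix.of fun a b => pd i (fun y => A y a b) x

theorem contDiffOn_pdVec {V : Coord m → Fin n → ℝ} (hs : IsOpen s) (hV : ContDiffOn ℝ ∞ V s)
    (i : Fin m) : ContDiffOn ℝ ∞ (pdVec i V) s :=
  contDiffOn_pi.2 fun a => contDiffOn_pd hs (contDiffOn_pi.1 hV a) i

theorem contDiffOn_mulVec {k : ℕ} {A : Coord m → Matrix (Fin k) (Fin n) ℝ}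
    {V : Coord m → Fin n → ℝ} (hA : ∀ a b, ContDiffOn ℝ ∞ (fun y => A y a b) s)
    (hV : ContDiffOn ℝ ∞ V s) : ContDiffOn ℝ ∞ (fun y => (A y).mulVec (V y)) s := by
  refine contDiffOn_pi.2 fun a => ?_
  simp only [Matrix.mulVec, dotProduct]
  exact ContDiffOn.sum fun b _ => (hA a b).mul (contDiffOn_pi.1 hV b)

theorem pdVec_add {V W : Coord m → Fin n → ℝ} (hV : DifferentiableAt ℝ V x)
    (hW : DifferentiableAt ℝ W x) :
    pdVec i (fun y => V y + W y) x = pdVec i V x + pdVec i W x :=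
  funext fun a => pd_add (differentiableAt_pi.1 hV a) (differentiableAt_pi.1 hW a)

theorem pdVec_smul {V : Coord m → Fin n → ℝ} (hu : DifferentiableAt ℝ u x)
    (hV : DifferentiableAt ℝ V x) :
    pdVec i (fun y => u y • V y) x = pd i u x • V x + u x • pdVec i V x :=
  funext fun a => pd_mul hu (differentiableAt_pi.1 hV a)

theorem pd_dotProduct {V W : Coord m → Fin n → ℝ} (hV : DifferentiableAt ℝ V x)
    (hW : DifferentiableAt ℝ W x) :
    pd i (fun y => V y ⬝ᵥ W y) x = pdVec i V x ⬝ᵥ W x + V x ⬝ᵥ pdVec i W x := by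
  have dV := differentiableAt_pi.1 hV
  have dW := differentiableAt_pi.1 hW
  simp only [dotProduct]
  rw [pd_sum fun a _ => (dV a).fun_mul (dW a), ← Finset.sum_add_distrib]
  exact Finset.sum_congr rfl fun a _ => pd_mul (dV a) (dW a)

theorem pdVec_mulVec {k : ℕ} {A : Coord m → Matrix (Fin k) (Fin n) ℝ} {V : Coord m → Fin n → ℝ}
    (hA : ∀ a b, DifferentiableAt ℝ (fun y => A y a b) x) (hV : DifferentiableAt ℝ V x) :
    pdVec i (fun y => (A y).mulVec (V y)) x
      = (pdMat i A x).mulVec (V x) + (A x).mulVec (pdVec i V x) :=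
  funext fun a => pd_dotProduct (V := fun y => A y a) (differentiableAt_pi.2 (hA a)) hV

theorem pdMat_mul {k l p : ℕ} {A : Coord m → Matrix (Fin k) (Fin l) ℝ}
    {B : Coord m → Matrix (Fin l) (Fin p) ℝ}
    (hA : ∀ a b, DifferentiableAt ℝ (fun y => A y a b) x)
    (hB : ∀ a b, DifferentiableAt ℝ (fun y => B y a b) x) :
    pdMat i (fun y => A y * B y) x = pdMat i A x * B x + A x * pdMat i B x := by
  ext a b
  exact pd_dotProduct (V := fun y => A y a) (W := fun y c => B y c b)
    (differentiableAt_pi.2 (hA a)) (differentiableAt_pi.2 fun c => hB c b)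

theorem pd_trace {A : Coord m → Matrix (Fin n) (Fin n) ℝ}
    (hA : ∀ a b, DifferentiableAt ℝ (fun y => A y a b) x) :
    pd i (fun y => (A y).trace) x = (pdMat i A x).trace :=
  pd_sum fun a _ => hA a a

theorem dMap_eq_fderiv_apply {F : Coord m → Coord n} (hF : DifferentiableAt ℝ F x) (b : Fin n) :
    dMap F i x b = fderiv ℝ F x (EuclideanSpace.single i 1) b := by
  have := ((EuclideanSpace.proj (𝕜 := ℝ) b).hasFDerivAt (x := F x)).comp x hF.hasFDerivAt
  change fderiv ℝ ((EuclideanSpace.proj (𝕜 := ℝ) b) ∘ F) x _ = _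
  rw [this.fderiv]
  rfl

theorem coord_eq_sum (v : Coord n) : v = ∑ b, v b • EuclideanSpace.single b (1 : ℝ) := by
  simpa using ((EuclideanSpace.basisFun (Fin n) ℝ).sum_repr v).symm

theorem pd_comp {F : Coord m → Coord n} {k : Coord n → ℝ}
    (hk : DifferentiableAt ℝ k (F x)) (hF : DifferentiableAt ℝ F x) :
    pd i (fun y => k (F y)) x = ∑ b, pd b k (F x) * dMap F i x b := by
  have h : pd i (fun y => k (F y)) x
      = fderiv ℝ k (F x) (fderiv ℝ F x (EuclideanSpace.single i 1)) := by
    change fderiv ℝ (k ∘ F) x _ = _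
    rw [fderiv_comp x hk hF]
    rfl
  rw [h, coord_eq_sum (fderiv ℝ F x _), map_sum]
  simp [dMap_eq_fderiv_apply hF, pd, mul_comm]

theorem contDiffOn_apply {F : Coord m → Coord n} (hF : ContDiffOn ℝ ∞ F s) (a : Fin n) :
    ContDiffOn ℝ ∞ (fun y => F y a) s :=
  (EuclideanSpace.proj (𝕜 := ℝ) a).contDiff.comp_contDiffOn hF

theorem contDiffOn_dMap (hs : IsOpen s) {F : Coord m → Coord n} (hF : ContDiffOn ℝ ∞ F s)
    (i : Fin m) : ContDiffOn ℝ ∞ (dMap F i) s :=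
  contDiffOn_pi.2 fun a => contDiffOn_pd hs (contDiffOn_apply hF a) i

theorem pd_dMap_comm (hs : IsOpen s) {F : Coord m → Coord n} (hF : ContDiffOn ℝ ∞ F s)
    (hx : x ∈ s) (a : Fin n) :
    pd i (fun y => dMap F j y a) x = pd j (fun y => dMap F i y a) x :=
  pd_comm hs (contDiffOn_apply hF a) hx

end Calculus

section Bil

variable {n : ℕ} {B : Matrix (Fin n) (Fin n) ℝ}

/-- The bilinear form with Gram matrix `B`; for `B = K (F x)` it is the metric of the target at
`F x`, applied to components of vector fields along `F`. -/
def bil (B : Matrix (Fin n) (Fin n) ℝ) : (Fin n → ℝ) →ₗ[ℝ] (Fin n → ℝ) →ₗ[ℝ] ℝ :=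
  Matrix.toLinearMap₂' ℝ B

theorem bil_apply (B : Matrix (Fin n) (Fin n) ℝ) (v w : Fin n → ℝ) :
    bil B v w = ∑ a, ∑ b, B a b * v a * w b := by
  simp only [bil, Matrix.toLinearMap₂'_apply, smul_eq_mul]
  exact Finset.sum_congr rfl fun a _ => Finset.sum_congr rfl fun b _ => by ring

theorem bil_eq_dotProduct_mulVec (B : Matrix (Fin n) (Fin n) ℝ) (v w : Fin n → ℝ) :
    bil B v w = v ⬝ᵥ B.mulVec w :=
  Matrix.toLinearMap₂'_apply' B v w

theorem bil_comm (hB : B.IsSymm) (v w : Fin n → ℝ) : bil B v w = bil B w v := by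
  rw [bil_eq_dotProduct_mulVec, bil_eq_dotProduct_mulVec, Matrix.dotProduct_mulVec,
    ← Matrix.mulVec_transpose, hB, dotProduct_comm]

theorem bil_pos (hB : B.PosDef) {v : Fin n → ℝ} (hv : v ≠ 0) : 0 < bil B v v := by
  simpa [bil_eq_dotProduct_mulVec] using hB.dotProduct_mulVec_pos hv

end Bil

/-! ### Riemannian metrics on open subsets of coordinate space -/

section Metric

/-- `K` is a smooth Riemannian metric on the open set `W`. -/
structure IsMetricOn {n : ℕ} (K : Coord n → Matrix (Fin n) (Fin n) ℝ) (W : Set (Coord n)) :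
    Prop where
  isOpen : IsOpen W
  smooth : ∀ a b, ContDiffOn ℝ ∞ (fun y => K y a b) W
  posDef : ∀ y ∈ W, (K y).PosDef

variable {n : ℕ} {K : Coord n → Matrix (Fin n) (Fin n) ℝ} {W : Set (Coord n)} {y : Coord n}

/-- The matrix `(Γ^a_ic)_{a,c}` of the covariant derivative in the coordinate direction `i`. -/
def christoffelMatrix (K : Coord n → Matrix (Fin n) (Fin n) ℝ) (i : Fin n) (y : Coord n) :
    Matrix (Fin n) (Fin n) ℝ :=
  Matrix.of fun a c => christoffel K y a i c

theorem contDiffOn_det {E ι : Type*} [NormedAddCommGroup E] [NormedSpace ℝ E] [Fintype ι]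
    [DecidableEq ι] {A : E → Matrix ι ι ℝ} {s : Set E}
    (hA : ∀ a b, ContDiffOn ℝ ∞ (fun y => A y a b) s) : ContDiffOn ℝ ∞ (fun y => (A y).det) s := by
  simp only [Matrix.det_apply, Units.smul_def, zsmul_eq_mul]
  exact ContDiffOn.sum fun σ _ => contDiffOn_const.mul (contDiffOn_prod fun i _ => hA _ _)

theorem contDiffOn_matrix_inv {E ι : Type*} [NormedAddCommGroup E] [NormedSpace ℝ E] [Fintype ι]
    [DecidableEq ι] {A : E → Matrix ι ι ℝ} {s : Set E}
    (hA : ∀ a b, ContDiffOn ℝ ∞ (fun y => A y a b) s) (hd : ∀ y ∈ s, (A y).det ≠ 0) (a b : ι) :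
    ContDiffOn ℝ ∞ (fun y => (A y)⁻¹ a b) s := by
  simp only [Matrix.inv_def, Ring.inverse_eq_inv', Matrix.smul_apply, smul_eq_mul,
    Matrix.adjugate_apply]
  refine ((contDiffOn_det hA).inv hd).mul (contDiffOn_det fun c d => ?_)
  obtain rfl | h := eq_or_ne c b
  · simpa using contDiffOn_const
  · simpa [Matrix.updateRow_ne h] using hA c d

namespace IsMetricOn

theorem isSymm (hK : IsMetricOn K W) (hy : y ∈ W) : (K y).IsSymm := by
  simpa [Matrix.IsHermitian, Matrix.IsSymm] using (hK.posDef y hy).isHermitian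

theorem symm (hK : IsMetricOn K W) (hy : y ∈ W) (a b : Fin n) : K y a b = K y b a :=
  (hK.isSymm hy).apply b a

theorem inv_isSymm (hK : IsMetricOn K W) (hy : y ∈ W) : (K y)⁻¹.IsSymm := by
  rw [Matrix.IsSymm, Matrix.transpose_nonsing_inv, hK.isSymm hy]

theorem inv_symm (hK : IsMetricOn K W) (hy : y ∈ W) (a b : Fin n) : (K y)⁻¹ a b = (K y)⁻¹ b a :=
  (hK.inv_isSymm hy).apply b a

theorem det_ne_zero (hK : IsMetricOn K W) (hy : y ∈ W) : (K y).det ≠ 0 :=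
  (hK.posDef y hy).det_pos.ne'

theorem inv_mul (hK : IsMetricOn K W) (hy : y ∈ W) : (K y)⁻¹ * K y = 1 :=
  Matrix.nonsing_inv_mul _ (hK.det_ne_zero hy).isUnit

theorem mul_inv (hK : IsMetricOn K W) (hy : y ∈ W) : K y * (K y)⁻¹ = 1 :=
  Matrix.mul_nonsing_inv _ (hK.det_ne_zero hy).isUnit

theorem smooth_inv (hK : IsMetricOn K W) (a b : Fin n) :
    ContDiffOn ℝ ∞ (fun y => (K y)⁻¹ a b) W :=
  contDiffOn_matrix_inv hK.smooth (fun _ hy => hK.det_ne_zero hy) a b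

theorem smooth_christoffel (hK : IsMetricOn K W) (a b c : Fin n) :
    ContDiffOn ℝ ∞ (fun y => christoffel K y a b c) W :=
  have smooth_pd (a b c : Fin n) := contDiffOn_pd hK.isOpen (hK.smooth a b) c
  contDiffOn_const.mul (ContDiffOn.sum fun l _ => (hK.smooth_inv a l).mul
    (((smooth_pd _ _ _).add (smooth_pd _ _ _)).sub (smooth_pd _ _ _)))

theorem pd_symm (hK : IsMetricOn K W) (hy : y ∈ W) (i a b : Fin n) :
    pd i (fun z => K z a b) y = pd i (fun z => K z b a) y :=
  pd_congr hK.isOpen hy fun _ hz => hK.symm hz a b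

theorem christoffel_symm (hK : IsMetricOn K W) (hy : y ∈ W) (a b c : Fin n) :
    christoffel K y a b c = christoffel K y a c b := by
  simp only [christoffel, hK.pd_symm hy _ b c, add_comm (pd b _ y)]

theorem mul_christoffelMatrix_apply (hK : IsMetricOn K W) (hy : y ∈ W) (d b c : Fin n) :
    (K y * christoffelMatrix K b y) d c = 1 / 2 * (pd b (fun z => K z c d) y
      + pd c (fun z => K z b d) y - pd d (fun z => K z b c) y) := by
  set S : Fin n → ℝ := fun l => 1 / 2 * (pd b (fun z => K z c l) y + pd c (fun z => K z b l) y
    - pd l (fun z => K z b c) y)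
  have hΓ : (fun a => christoffelMatrix K b y a c) = (K y)⁻¹.mulVec S := by
    funext a
    simp only [christoffelMatrix, Matrix.of_apply, christoffel, Matrix.mulVec, dotProduct, S,
      Finset.mul_sum]
    exact Finset.sum_congr rfl fun l _ => by ring
  calc (K y * christoffelMatrix K b y) d c
      = (K y).mulVec ((K y)⁻¹.mulVec S) d := by rw [← hΓ]; rfl
    _ = S d := by rw [Matrix.mulVec_mulVec, hK.mul_inv hy, Matrix.one_mulVec]

theorem pdMat_eq (hK : IsMetricOn K W) (hy : y ∈ W) (c : Fin n) :
    pdMat c K y = (christoffelMatrix K c y).transpose * K y + K y * christoffelMatrix K c y := by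
  have htr : (christoffelMatrix K c y).transpose * K y
      = (K y * christoffelMatrix K c y).transpose := by
    rw [Matrix.transpose_mul, hK.isSymm hy]
  ext a b
  rw [htr, Matrix.add_apply, Matrix.transpose_apply, hK.mul_christoffelMatrix_apply hy,
    hK.mul_christoffelMatrix_apply hy, hK.pd_symm hy c b a, hK.pd_symm hy a c b,
    hK.pd_symm hy b c a, pdMat, Matrix.of_apply]
  ring

theorem pdMat_inv (hK : IsMetricOn K W) (hy : y ∈ W) (c : Fin n) :
    pdMat c (fun z => (K z)⁻¹) y = -(christoffelMatrix K c y * (K y)⁻¹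
      + (K y)⁻¹ * (christoffelMatrix K c y).transpose) := by
  have hone : pdMat c (fun z => (K z)⁻¹ * K z) y = 0 := by
    ext a b
    exact (pd_congr hK.isOpen hy fun z hz => congr_fun₂ (hK.inv_mul hz) a b).trans (pd_const _)
  have hleibniz : pdMat c (fun z => (K z)⁻¹) y * K y = -((K y)⁻¹ * pdMat c K y) := by
    rw [eq_neg_iff_add_eq_zero, ← hone,
      pdMat_mul (fun a b => differentiableAt_of_contDiffOn (hK.smooth_inv a b) hK.isOpen hy)
        (fun a b => differentiableAt_of_contDiffOn (hK.smooth a b) hK.isOpen hy)]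
  calc pdMat c (fun z => (K z)⁻¹) y
      = pdMat c (fun z => (K z)⁻¹) y * K y * (K y)⁻¹ := by
        rw [mul_assoc, hK.mul_inv hy, mul_one]
    _ = -((K y)⁻¹ * ((christoffelMatrix K c y).transpose * K y
          + K y * christoffelMatrix K c y) * (K y)⁻¹) := by
        rw [hleibniz, hK.pdMat_eq hy, neg_mul]
    _ = _ := by
        rw [mul_add, add_mul, ← mul_assoc (K y)⁻¹ (K y), hK.inv_mul hy, one_mul, ← mul_assoc,
          mul_assoc, hK.mul_inv hy, mul_one, add_comm]

end IsMetricOn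

end Metric

/-! ### Vector fields along a map -/

section Along

variable {m n : ℕ} {K : Coord n → Matrix (Fin n) (Fin n) ℝ} {W : Set (Coord n)}
  {F : Coord m → Coord n} {s : Set (Coord m)} {V V' : Coord m → Fin n → ℝ} {u : Coord m → ℝ}
  {x : Coord m} {i j : Fin m}

/-- `F` is a smooth map from the open set `s` to `W`. -/
structure IsSmoothMapOn (F : Coord m → Coord n) (s : Set (Coord m)) (W : Set (Coord n)) :
    Prop where
  isOpen : IsOpen s
  smooth : ContDiffOn ℝ ∞ F s
  mapsTo : Set.MapsTo F s W

theorem IsSmoothMapOn.differentiableAt (hF : IsSmoothMapOn F s W) (hx : x ∈ s) :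
    DifferentiableAt ℝ F x :=
  differentiableAt_of_contDiffOn hF.smooth hF.isOpen hx

/-- The connection matrix `ω_i = ∂_i F^b Γ_b(F)` of the pull-back connection `∇^F`. -/
def connMatrix (K : Coord n → Matrix (Fin n) (Fin n) ℝ) (F : Coord m → Coord n) (i : Fin m)
    (x : Coord m) : Matrix (Fin n) (Fin n) ℝ :=
  ∑ b, dMap F i x b • christoffelMatrix K b (F x)

theorem connMatrix_apply (a c : Fin n) :
    connMatrix K F i x a c = ∑ b, christoffel K (F x) a b c * dMap F i x b := by
  simp [connMatrix, christoffelMatrix, Matrix.sum_apply, mul_comm]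

theorem covAlong_eq (V : Coord m → Fin n → ℝ) (i : Fin m) (x : Coord m) :
    covAlong K F V i x = pdVec i V x + (connMatrix K F i x).mulVec (V x) := by
  funext a
  simp only [covAlong, Pi.add_apply, pdVec, Matrix.mulVec, dotProduct, connMatrix_apply,
    Finset.sum_mul]
  rw [Finset.sum_comm]

theorem covAlong_congr (hs : IsOpen s) (hx : x ∈ s) (h : Set.EqOn V V' s) :
    covAlong K F V i x = covAlong K F V' i x := by
  have hpd : pdVec i V x = pdVec i V' x :=
    funext fun a => pd_congr hs hx fun y hy => congr_fun (h hy) a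
  rw [covAlong_eq, covAlong_eq, hpd, h hx]

theorem contDiffOn_connMatrix (hK : IsMetricOn K W) (hF : IsSmoothMapOn F s W) (i : Fin m)
    (a c : Fin n) : ContDiffOn ℝ ∞ (fun y => connMatrix K F i y a c) s := by
  simp only [connMatrix_apply]
  exact ContDiffOn.sum fun b _ => ((hK.smooth_christoffel a b c).comp hF.smooth hF.mapsTo).mul
    (contDiffOn_pi.1 (contDiffOn_dMap hF.isOpen hF.smooth i) b)

theorem contDiffOn_covAlong (hK : IsMetricOn K W) (hF : IsSmoothMapOn F s W)
    (hV : ContDiffOn ℝ ∞ V s) (i : Fin m) : ContDiffOn ℝ ∞ (covAlong K F V i) s := by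
  simp only [funext (covAlong_eq V i)]
  exact (contDiffOn_pdVec hF.isOpen hV i).add
    (contDiffOn_mulVec (contDiffOn_connMatrix hK hF i) hV)

theorem contDiffOn_bil (hK : IsMetricOn K W) (hF : IsSmoothMapOn F s W)
    (hV : ContDiffOn ℝ ∞ V s) (hV' : ContDiffOn ℝ ∞ V' s) :
    ContDiffOn ℝ ∞ (fun y => bil (K (F y)) (V y) (V' y)) s := by
  simp only [bil_apply]
  exact ContDiffOn.sum fun a _ => ContDiffOn.sum fun b _ =>
    (((hK.smooth a b).comp hF.smooth hF.mapsTo).mul (contDiffOn_pi.1 hV a)).mul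
      (contDiffOn_pi.1 hV' b)

theorem covAlong_smul (hu : DifferentiableAt ℝ u x) (hV : DifferentiableAt ℝ V x) :
    covAlong K F (fun y => u y • V y) i x = pd i u x • V x + u x • covAlong K F V i x := by
  simp only [covAlong_eq, pdVec_smul hu hV, Matrix.mulVec_smul, smul_add, add_assoc]

theorem covAlong_add (hV : DifferentiableAt ℝ V x) (hV' : DifferentiableAt ℝ V' x) :
    covAlong K F (fun y => V y + V' y) i x = covAlong K F V i x + covAlong K F V' i x := by
  simp only [covAlong_eq, pdVec_add hV hV', Matrix.mulVec_add]
  abel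

theorem pdMat_metric_comp (hK : IsMetricOn K W) (hF : IsSmoothMapOn F s W) (hx : x ∈ s) :
    pdMat i (fun y => K (F y)) x
      = (connMatrix K F i x).transpose * K (F x) + K (F x) * connMatrix K F i x := by
  have hchain : pdMat i (fun y => K (F y)) x = ∑ b, dMap F i x b • pdMat b K (F x) := by
    ext a c
    simpa [pdMat, Matrix.sum_apply, mul_comm] using pd_comp (k := fun z => K z a c)
      (differentiableAt_of_contDiffOn (hK.smooth a c) hK.isOpen (hF.mapsTo hx))
      (hF.differentiableAt hx)
  simp only [hchain, hK.pdMat_eq (hF.mapsTo hx), connMatrix, Matrix.transpose_sum,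
    Matrix.transpose_smul, Finset.sum_mul, Finset.mul_sum, smul_add, Finset.sum_add_distrib,
    smul_mul_assoc, mul_smul_comm]

theorem pd_bil (hK : IsMetricOn K W) (hF : IsSmoothMapOn F s W) (hx : x ∈ s)
    (hV : ContDiffOn ℝ ∞ V s) (hV' : ContDiffOn ℝ ∞ V' s) :
    pd i (fun y => bil (K (F y)) (V y) (V' y)) x
      = bil (K (F x)) (covAlong K F V i x) (V' x) + bil (K (F x)) (V x) (covAlong K F V' i x) := by
  have hKF (a b : Fin n) : ContDiffOn ℝ ∞ (fun y => K (F y) a b) s :=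
    (hK.smooth a b).comp hF.smooth hF.mapsTo
  have diff {k : ℕ} {U : Coord m → Fin k → ℝ} (hU : ContDiffOn ℝ ∞ U s) :
      DifferentiableAt ℝ U x := differentiableAt_of_contDiffOn hU hF.isOpen hx
  have hadj : (connMatrix K F i x).mulVec (V x) ⬝ᵥ (K (F x)).mulVec (V' x)
      = V x ⬝ᵥ ((connMatrix K F i x).transpose * K (F x)).mulVec (V' x) := by
    rw [← Matrix.mulVec_mulVec, Matrix.dotProduct_mulVec _ (connMatrix K F i x).transpose,
      Matrix.vecMul_transpose]
  simp only [bil_eq_dotProduct_mulVec]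
  rw [pd_dotProduct (diff hV) (diff (contDiffOn_mulVec hKF hV')), pdVec_mulVec
    (fun a b => differentiableAt_of_contDiffOn (hKF a b) hF.isOpen hx) (diff hV'),
    pdMat_metric_comp hK hF hx]
  simp only [covAlong_eq, Matrix.mulVec_add, Matrix.add_mulVec, dotProduct_add, add_dotProduct,
    hadj, Matrix.mulVec_mulVec]
  ring

theorem pd_pd_bil (hK : IsMetricOn K W) (hF : IsSmoothMapOn F s W)
    (hx : x ∈ s) (hV : ContDiffOn ℝ ∞ V s) (hV' : ContDiffOn ℝ ∞ V' s) :
    pd i (pd j (fun y => bil (K (F y)) (V y) (V' y))) x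
      = bil (K (F x)) (covAlong K F (covAlong K F V j) i x) (V' x)
        + bil (K (F x)) (covAlong K F V j x) (covAlong K F V' i x)
        + (bil (K (F x)) (covAlong K F V i x) (covAlong K F V' j x)
        + bil (K (F x)) (V x) (covAlong K F (covAlong K F V' j) i x)) := by
  have hDV := contDiffOn_covAlong hK hF hV j
  have hDV' := contDiffOn_covAlong hK hF hV' j
  rw [pd_congr hF.isOpen hx fun y hy => pd_bil hK hF hy hV hV',
    pd_add (differentiableAt_of_contDiffOn (contDiffOn_bil hK hF hDV hV') hF.isOpen hx)
      (differentiableAt_of_contDiffOn (contDiffOn_bil hK hF hV hDV') hF.isOpen hx),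
    pd_bil hK hF hx hDV hV', pd_bil hK hF hx hV hDV']

theorem covAlong_dMap_comm (hK : IsMetricOn K W) (hF : IsSmoothMapOn F s W) (hx : x ∈ s) :
    covAlong K F (dMap F j) i x = covAlong K F (dMap F i) j x := by
  funext a
  simp only [covAlong]
  rw [pd_dMap_comm hF.isOpen hF.smooth hx, Finset.sum_comm]
  congr 1
  refine Finset.sum_congr rfl fun b _ => Finset.sum_congr rfl fun c _ => ?_
  rw [hK.christoffel_symm (hF.mapsTo hx)]
  ring

end Along

/-! ### Curvature -/

section Curvature

variable {n : ℕ} {K : Coord n → Matrix (Fin n) (Fin n) ℝ} {W : Set (Coord n)} {q : Coord n}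

/-- The curvature operator `R(X, Y)` at `q`, bilinear in `X` and `Y`. -/
def curv (K : Coord n → Matrix (Fin n) (Fin n) ℝ) (q : Coord n) :
    (Fin n → ℝ) →ₗ[ℝ] (Fin n → ℝ) →ₗ[ℝ] Module.End ℝ (Fin n → ℝ) :=
  Matrix.toLinearMap₂' ℝ
    (Matrix.of fun c d => Matrix.toLin' (Matrix.of fun a b => riemann K q a b c d))

theorem curv_apply (X Y Z : Fin n → ℝ) (a : Fin n) :
    curv K q X Y Z a = ∑ b, ∑ c, ∑ d, riemann K q a b c d * X c * Y d * Z b := by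
  simp only [curv, Matrix.toLinearMap₂'_apply, LinearMap.sum_apply, LinearMap.smul_apply,
    Matrix.of_apply, Matrix.toLin'_apply, Finset.sum_apply, Pi.smul_apply, smul_eq_mul,
    Matrix.mulVec, dotProduct, Finset.mul_sum]
  rw [Finset.sum_comm_cycle]
  exact Finset.sum_congr rfl fun b _ => Finset.sum_congr rfl fun c _ =>
    Finset.sum_congr rfl fun d _ => by ring

theorem curv_antisymm (X Y : Fin n → ℝ) : curv K q X Y = -curv K q Y X := by
  have riemann_antisymm (a b c d : Fin n) : riemann K q a b c d = -riemann K q a b d c := by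
    simp only [riemann, Finset.sum_sub_distrib]
    ring
  refine LinearMap.ext fun Z => funext fun a => ?_
  simp only [LinearMap.neg_apply, curv_apply, Pi.neg_apply, ← Finset.sum_neg_distrib]
  refine Finset.sum_congr rfl fun b _ => ?_
  rw [Finset.sum_comm]
  refine Finset.sum_congr rfl fun c _ => Finset.sum_congr rfl fun d _ => ?_
  rw [riemann_antisymm]
  ring

theorem IsMetricOn.riemann_cyclic (hK : IsMetricOn K W) (hq : q ∈ W) (a b c d : Fin n) :
    riemann K q a b c d + riemann K q a c d b + riemann K q a d b c = 0 := by
  have pd_christoffel_symm (i k l : Fin n) : pd i (fun y => christoffel K y a k l) q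
      = pd i (fun y => christoffel K y a l k) q :=
    pd_congr hK.isOpen hq fun y hy => hK.christoffel_symm hy a k l
  have sum_christoffel_symm (k l m : Fin n) :
      ∑ s, christoffel K q a k s * christoffel K q s l m
        = ∑ s, christoffel K q a k s * christoffel K q s m l :=
    Finset.sum_congr rfl fun s _ => by rw [hK.christoffel_symm hq s l m]
  simp only [riemann, Finset.sum_sub_distrib]
  rw [pd_christoffel_symm c d b, pd_christoffel_symm d c b, pd_christoffel_symm b c d,
    sum_christoffel_symm c d b, sum_christoffel_symm d c b, sum_christoffel_symm b c d]
  ring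

theorem IsMetricOn.curv_cyclic (hK : IsMetricOn K W) (hq : q ∈ W) (X Y Z : Fin n → ℝ) :
    curv K q X Y Z + curv K q Y Z X + curv K q Z X Y = 0 := by
  funext a
  have hYZX : curv K q Y Z X a = ∑ b, ∑ c, ∑ d, riemann K q a c d b * X c * Y d * Z b := by
    rw [curv_apply, Finset.sum_comm_cycle]
    exact Finset.sum_congr rfl fun b _ => Finset.sum_congr rfl fun c _ =>
      Finset.sum_congr rfl fun d _ => by ring
  have hZXY : curv K q Z X Y a = ∑ b, ∑ c, ∑ d, riemann K q a d b c * X c * Y d * Z b := by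
    rw [curv_apply, ← Finset.sum_comm_cycle]
    exact Finset.sum_congr rfl fun b _ => Finset.sum_congr rfl fun c _ =>
      Finset.sum_congr rfl fun d _ => by ring
  simp only [Pi.add_apply, Pi.zero_apply, hYZX, hZXY, curv_apply, ← Finset.sum_add_distrib,
    ← add_mul, hK.riemann_cyclic hq, zero_mul, Finset.sum_const_zero]

section PullBack

variable {m : ℕ} {F : Coord m → Coord n} {s : Set (Coord m)} {V : Coord m → Fin n → ℝ}
  {x : Coord m} {i j : Fin m}

theorem covAlong_covAlong (hK : IsMetricOn K W) (hF : IsSmoothMapOn F s W) (hx : x ∈ s)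
    (hV : ContDiffOn ℝ ∞ V s) :
    covAlong K F (covAlong K F V j) i x = pdVec i (pdVec j V) x
      + (pdMat i (connMatrix K F j) x + connMatrix K F i x * connMatrix K F j x).mulVec (V x)
      + ((connMatrix K F j x).mulVec (pdVec i V x)
        + (connMatrix K F i x).mulVec (pdVec j V x)) := by
  have hω := contDiffOn_connMatrix hK hF j
  have diff {U : Coord m → Fin n → ℝ} (hU : ContDiffOn ℝ ∞ U s) : DifferentiableAt ℝ U x :=
    differentiableAt_of_contDiffOn hU hF.isOpen hx
  rw [covAlong_eq, funext (covAlong_eq V j), pdVec_add (diff (contDiffOn_pdVec hF.isOpen hV j))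
    (diff (contDiffOn_mulVec hω hV)), pdVec_mulVec
    (fun a b => differentiableAt_of_contDiffOn (hω a b) hF.isOpen hx) (diff hV)]
  simp only [Matrix.mulVec_add, Matrix.add_mulVec, Matrix.mulVec_mulVec]
  abel

theorem pd_connMatrix_apply (hK : IsMetricOn K W) (hF : IsSmoothMapOn F s W) (hx : x ∈ s)
    (a c : Fin n) :
    pd i (fun y => connMatrix K F j y a c) x
      = ∑ b, ∑ e, pd b (fun z => christoffel K z a e c) (F x) * dMap F i x b * dMap F j x e
        + ∑ b, christoffel K (F x) a b c * pd i (fun y => dMap F j y b) x := by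
  have hΓ (b : Fin n) := hK.smooth_christoffel a b c
  have dΓF (b : Fin n) : DifferentiableAt ℝ (fun y => christoffel K (F y) a b c) x :=
    differentiableAt_of_contDiffOn ((hΓ b).comp hF.smooth hF.mapsTo) hF.isOpen hx
  have ddF (b : Fin n) : DifferentiableAt ℝ (fun y => dMap F j y b) x :=
    differentiableAt_pi.1
      (differentiableAt_of_contDiffOn (contDiffOn_dMap hF.isOpen hF.smooth j) hF.isOpen hx) b
  have hchain (b : Fin n) : pd i (fun y => christoffel K (F y) a b c) x
      = ∑ e, pd e (fun z => christoffel K z a b c) (F x) * dMap F i x e :=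
    pd_comp (differentiableAt_of_contDiffOn (hΓ b) hK.isOpen (hF.mapsTo hx))
      (hF.differentiableAt hx)
  simp only [connMatrix_apply]
  rw [pd_sum fun b _ => (dΓF b).fun_mul (ddF b), Finset.sum_comm, ← Finset.sum_add_distrib]
  refine Finset.sum_congr rfl fun b _ => ?_
  rw [pd_mul (dΓF b) (ddF b), hchain, Finset.sum_mul]

theorem connMatrix_mul_apply (a b : Fin n) :
    (connMatrix K F i x * connMatrix K F j x) a b
      = ∑ c, ∑ d, (∑ e, christoffel K (F x) a c e * christoffel K (F x) e d b)
        * dMap F i x c * dMap F j x d := by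
  simp only [Matrix.mul_apply, connMatrix_apply, Finset.sum_mul_sum]
  simp only [Finset.sum_mul]
  rw [← Finset.sum_comm_cycle]
  exact Finset.sum_congr rfl fun c _ => Finset.sum_congr rfl fun d _ =>
    Finset.sum_congr rfl fun e _ => by ring

-- Cartan's structure equation `dω + ω ∧ ω = F^* R`.
theorem pdMat_connMatrix_sub (hK : IsMetricOn K W) (hF : IsSmoothMapOn F s W) (hx : x ∈ s) :
    pdMat i (connMatrix K F j) x + connMatrix K F i x * connMatrix K F j x
        - (pdMat j (connMatrix K F i) x + connMatrix K F j x * connMatrix K F i x)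
      = (curv K (F x) (dMap F i x) (dMap F j x)).toMatrix' := by
  ext a b
  have hcurv : (curv K (F x) (dMap F i x) (dMap F j x)).toMatrix' a b
      = ∑ c, ∑ d, riemann K (F x) a b c d * dMap F i x c * dMap F j x d := by
    simp [LinearMap.toMatrix'_apply, curv_apply, Pi.single_apply]
  have hswap (f : Fin n → Fin n → ℝ) : ∑ c, ∑ d, f c d * dMap F j x c * dMap F i x d
      = ∑ c, ∑ d, f d c * dMap F i x c * dMap F j x d := by
    rw [Finset.sum_comm]
    exact Finset.sum_congr rfl fun _ _ => Finset.sum_congr rfl fun _ _ => by ring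
  simp only [Matrix.sub_apply, Matrix.add_apply, pdMat, Matrix.of_apply,
    pd_connMatrix_apply hK hF hx, connMatrix_mul_apply, hcurv, riemann,
    pd_dMap_comm (i := j) (j := i) hF.isOpen hF.smooth hx]
  rw [hswap, hswap fun c d => ∑ e, _]
  simp only [Finset.sum_sub_distrib, add_mul, sub_mul, Finset.sum_add_distrib]
  ring

theorem covAlong_covAlong_sub (hK : IsMetricOn K W) (hF : IsSmoothMapOn F s W) (hx : x ∈ s)
    (hV : ContDiffOn ℝ ∞ V s) :
    covAlong K F (covAlong K F V j) i x - covAlong K F (covAlong K F V i) j x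
      = curv K (F x) (dMap F i x) (dMap F j x) (V x) := by
  have hcomm : pdVec i (pdVec j V) x = pdVec j (pdVec i V) x :=
    funext fun a => pd_comm hF.isOpen (contDiffOn_pi.1 hV a) hx
  rw [← LinearMap.toMatrix'_mulVec, ← pdMat_connMatrix_sub hK hF hx, Matrix.sub_mulVec,
    covAlong_covAlong hK hF hx hV, covAlong_covAlong hK hF hx hV, hcomm]
  abel

end PullBack

theorem dMap_id (i : Fin n) (q : Coord n) : dMap (fun y : Coord n => y) i q = Pi.single i 1 := by
  funext a
  simp [dMap_eq_fderiv_apply differentiableAt_fun_id, Pi.single_apply]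

namespace IsMetricOn

-- The second derivatives of `⟨Z, V⟩` commute, for constant vector fields `Z` and `V`.
theorem bil_curv_single_antisymm (hK : IsMetricOn K W) (hq : q ∈ W) (i j : Fin n)
    (Z V : Fin n → ℝ) :
    bil (K q) (curv K q (Pi.single i 1) (Pi.single j 1) Z) V
      = -bil (K q) (curv K q (Pi.single i 1) (Pi.single j 1) V) Z := by
  have hid : IsSmoothMapOn (fun y : Coord n => y) W W :=
    ⟨hK.isOpen, contDiffOn_id, fun _ hy => hy⟩
  have hconst (T : Fin n → ℝ) : ContDiffOn ℝ ∞ (fun _ : Coord n => T) W := contDiffOn_const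
  have hR (T : Fin n → ℝ) :=
    covAlong_covAlong_sub (i := i) (j := j) hK hid hq (hconst T)
  have hcomm := pd_comm (i := i) (j := j) hK.isOpen
    (contDiffOn_bil hK hid (hconst Z) (hconst V)) hq
  rw [pd_pd_bil hK hid hq (hconst Z) (hconst V), pd_pd_bil hK hid hq (hconst Z) (hconst V)]
    at hcomm
  simp only [dMap_id] at hR
  rw [← hR, ← hR, bil_comm (hK.isSymm hq) _ Z, map_sub, map_sub, LinearMap.sub_apply]
  linarith

theorem bil_curv_antisymm (hK : IsMetricOn K W) (hq : q ∈ W) (X Y Z V : Fin n → ℝ) :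
    bil (K q) (curv K q X Y Z) V = -bil (K q) (curv K q X Y V) Z := by
  have hX : X = ∑ i, X i • Pi.single i 1 := pi_eq_sum_univ' X
  have hY : Y = ∑ i, Y i • Pi.single i 1 := pi_eq_sum_univ' Y
  rw [hX, hY]
  simp only [map_sum, map_smul, LinearMap.sum_apply, LinearMap.smul_apply, smul_eq_mul,
    hK.bil_curv_single_antisymm hq _ _ Z V, Finset.sum_neg_distrib, mul_neg]

theorem bil_curv_pair (hK : IsMetricOn K W) (hq : q ∈ W) (X Y Z V : Fin n → ℝ) :
    bil (K q) (curv K q X Y Z) V = bil (K q) (curv K q Z V X) Y := by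
  have cyc (X Y Z V : Fin n → ℝ) : bil (K q) (curv K q X Y Z) V + bil (K q) (curv K q Y Z X) V
      + bil (K q) (curv K q Z X Y) V = 0 := by
    rw [← LinearMap.add_apply, ← LinearMap.add_apply, ← map_add, ← map_add, hK.curv_cyclic hq,
      map_zero, LinearMap.zero_apply]
  have anti₁₂ (X Y Z V : Fin n → ℝ) : bil (K q) (curv K q X Y Z) V
      = -bil (K q) (curv K q Y X Z) V := by
    rw [curv_antisymm, LinearMap.neg_apply, map_neg, LinearMap.neg_apply]
  have anti₃₄ := hK.bil_curv_antisymm hq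
  linarith [cyc X Y Z V, cyc Y Z V X, cyc Z V X Y, cyc V X Y Z, anti₃₄ Y Z X V, anti₃₄ Z V X Y,
    anti₁₂ V Y Z X, anti₁₂ X Z V Y, anti₃₄ Z X V Y, anti₃₄ V X Y Z, anti₃₄ X Y Z V, anti₃₄ Y V X Z]

end IsMetricOn

/-- The Ricci tensor at `q` as a bilinear form. -/
def ric (K : Coord n → Matrix (Fin n) (Fin n) ℝ) (q : Coord n) :
    (Fin n → ℝ) →ₗ[ℝ] (Fin n → ℝ) →ₗ[ℝ] ℝ :=
  bil (Matrix.of (ricci K q))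

theorem ric_eq_trace (X Y : Fin n → ℝ) :
    ric K q X Y = LinearMap.trace ℝ _ (((curv K q).flip X).flip Y) := by
  have hcomp : ric K q X Y = ∑ i, curv K q (Pi.single i 1) X Y i := by
    rw [ric, bil_apply]
    simp only [Matrix.of_apply, ricci, curv_apply, Pi.single_apply, Finset.sum_mul, mul_ite,
      mul_one, mul_zero, ite_mul, zero_mul, Finset.sum_ite_irrel, Finset.sum_const_zero,
      Finset.sum_ite_eq', Finset.mem_univ, if_true]
    rw [Finset.sum_comm_cycle]
    exact Finset.sum_congr rfl fun i _ => Finset.sum_comm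
  rw [hcomp, LinearMap.trace_eq_matrix_trace ℝ (Pi.basisFun ℝ (Fin n))]
  simp [Matrix.trace]

end Curvature

/-! ### The bitension field as the value of a linear operator -/

section Jacobi

variable {m n : ℕ} {E : Type*} [AddCommGroup E] [Module ℝ E]

/-- The trace `g^{ij} T_ij` of a two-index array with respect to the metric with matrix `g`. -/
def metricTrace (g : Matrix (Fin m) (Fin m) ℝ) : (Fin m → Fin m → E) →ₗ[ℝ] E where
  toFun T := ∑ i, ∑ j, g⁻¹ i j • T i j
  map_add' T T' := by simp only [Pi.add_apply, smul_add, Finset.sum_add_distrib]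
  map_smul' c T := by
    simp only [Pi.smul_apply, smul_comm _ c, Finset.smul_sum, RingHom.id_apply]

theorem metricTrace_apply (g : Matrix (Fin m) (Fin m) ℝ) (T : Fin m → Fin m → E) :
    metricTrace g T = ∑ i, ∑ j, g⁻¹ i j • T i j :=
  rfl

theorem map_metricTrace {E' : Type*} [AddCommGroup E'] [Module ℝ E'] (L : E →ₗ[ℝ] E')
    (g : Matrix (Fin m) (Fin m) ℝ) (T : Fin m → Fin m → E) :
    L (metricTrace g T) = metricTrace g fun i j => L (T i j) := by
  simp only [metricTrace_apply, map_sum, map_smul]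

theorem metricTrace_smul (g : Matrix (Fin m) (Fin m) ℝ) (T : Fin m → Fin m → ℝ) (v : E) :
    metricTrace g T • v = metricTrace g fun i j => T i j • v :=
  map_metricTrace (LinearMap.toSpanSingleton ℝ E v) g T

theorem metricTrace_swap {g : Matrix (Fin m) (Fin m) ℝ} (hg : g⁻¹.IsSymm)
    (T : Fin m → Fin m → E) : metricTrace g (fun i j => T j i) = metricTrace g T := by
  simp only [metricTrace_apply]
  rw [Finset.sum_comm]
  exact Finset.sum_congr rfl fun i _ => Finset.sum_congr rfl fun j _ => by rw [hg.apply]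

variable {G : Coord m → Matrix (Fin m) (Fin m) ℝ}
  {K : Coord n → Matrix (Fin n) (Fin n) ℝ} {W : Set (Coord n)}
  {F : Coord m → Coord n} {s : Set (Coord m)} {V V' : Coord m → Fin n → ℝ} {u : Coord m → ℝ}
  {x : Coord m}

theorem tension_eq_metricTrace : tension G K F x = metricTrace (G x) fun i j =>
    covAlong K F (dMap F j) i x - ∑ k, christoffel G x k i j • dMap F k x := by
  funext a
  simp [tension, metricTrace_apply]

theorem roughLaplacian_eq_metricTrace (V : Coord m → Fin n → ℝ) :
    roughLaplacian G K F V x = metricTrace (G x) fun i j =>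
      covAlong K F (covAlong K F V j) i x - ∑ k, christoffel G x k i j • covAlong K F V k x := by
  funext a
  simp [roughLaplacian, metricTrace_apply]

theorem laplacian_eq_metricTrace (u : Coord m → ℝ) :
    laplacian G u x = metricTrace (G x) fun i j =>
      pd i (pd j u) x - ∑ k, christoffel G x k i j * pd k u x := by
  simp only [laplacian, metricTrace_apply, smul_eq_mul]

theorem sum_grad_smul (T : Fin m → E) :
    ∑ k, grad G u x k • T k = metricTrace (G x) fun i j => pd j u x • T i := by
  simp only [grad, metricTrace_apply, Finset.sum_smul, smul_smul]

/-- The field `Trace_g R^N(dF, Y) dF`. -/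
def curvTrace (G : Coord m → Matrix (Fin m) (Fin m) ℝ) (K : Coord n → Matrix (Fin n) (Fin n) ℝ)
    (F : Coord m → Coord n) (x : Coord m) (Y : Fin n → ℝ) : Fin n → ℝ :=
  metricTrace (G x) fun i j => curv K (F x) (dMap F i x) Y (dMap F j x)

/-- The Jacobi-type operator `V ↦ Trace_g (∇^F ∇^F - ∇^F_{∇^M}) V - Trace_g R^N(dF, V) dF`, whose
value at the tension field is the bitension field. -/
def jacobiOp (G : Coord m → Matrix (Fin m) (Fin m) ℝ) (K : Coord n → Matrix (Fin n) (Fin n) ℝ)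
    (F : Coord m → Coord n) (V : Coord m → Fin n → ℝ) (x : Coord m) : Fin n → ℝ :=
  roughLaplacian G K F V x - curvTrace G K F x (V x)

theorem bitension_eq_jacobiOp : bitension G K F x = jacobiOp G K F (tension G K F) x := by
  funext a
  simp only [bitension, jacobiOp, Pi.sub_apply, curvTrace, metricTrace_apply, Finset.sum_apply,
    Pi.smul_apply, curv_apply, smul_eq_mul]

theorem jacobiOp_congr (hs : IsOpen s) (hx : x ∈ s) (h : Set.EqOn V V' s) :
    jacobiOp G K F V x = jacobiOp G K F V' x := by
  have hcov (j : Fin m) : Set.EqOn (covAlong K F V j) (covAlong K F V' j) s :=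
    fun y hy => covAlong_congr hs hy h
  simp only [jacobiOp, roughLaplacian_eq_metricTrace, hcov _ hx,
    fun i j => covAlong_congr (i := i) (K := K) (F := F) hs hx (hcov j), h hx]

theorem curvTrace_smul (c : ℝ) (Y : Fin n → ℝ) :
    curvTrace G K F x (c • Y) = c • curvTrace G K F x Y := by
  simp only [curvTrace, map_smul, LinearMap.smul_apply]
  exact map_smul (metricTrace (G x)) c _

theorem covAlong_covAlong_smul (hK : IsMetricOn K W) (hF : IsSmoothMapOn F s W)
    (hx : x ∈ s) (hu : ContDiffOn ℝ ∞ u s) (hV : ContDiffOn ℝ ∞ V s) (i j : Fin m) :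
    covAlong K F (covAlong K F (fun y => u y • V y) j) i x
      = pd i (pd j u) x • V x + pd j u x • covAlong K F V i x
        + (pd i u x • covAlong K F V j x + u x • covAlong K F (covAlong K F V j) i x) := by
  have dpu := differentiableAt_of_contDiffOn (contDiffOn_pd hF.isOpen hu j) hF.isOpen hx
  have dDV := differentiableAt_of_contDiffOn (contDiffOn_covAlong hK hF hV j) hF.isOpen hx
  have du {y} (hy : y ∈ s) := differentiableAt_of_contDiffOn hu hF.isOpen hy
  have dV {y} (hy : y ∈ s) := differentiableAt_of_contDiffOn hV hF.isOpen hy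
  rw [covAlong_congr hF.isOpen hx fun y hy => covAlong_smul (du hy) (dV hy),
    covAlong_add (dpu.fun_smul (dV hx)) ((du hx).fun_smul dDV), covAlong_smul dpu (dV hx),
    covAlong_smul (du hx) dDV]

theorem roughLaplacian_smul (hG : IsMetricOn G s) (hK : IsMetricOn K W) (hF : IsSmoothMapOn F s W)
    (hx : x ∈ s) (hu : ContDiffOn ℝ ∞ u s) (hV : ContDiffOn ℝ ∞ V s) :
    roughLaplacian G K F (fun y => u y • V y) x
      = u x • roughLaplacian G K F V x + laplacian G u x • V x
        + (2 : ℝ) • ∑ k, grad G u x k • covAlong K F V k x := by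
  have hleibniz (i j : Fin m) : covAlong K F (covAlong K F (fun y => u y • V y) j) i x
      - ∑ k, christoffel G x k i j • covAlong K F (fun y => u y • V y) k x
      = u x • (covAlong K F (covAlong K F V j) i x
          - ∑ k, christoffel G x k i j • covAlong K F V k x)
        + (pd i (pd j u) x - ∑ k, christoffel G x k i j * pd k u x) • V x
        + (pd j u x • covAlong K F V i x + pd i u x • covAlong K F V j x) := by
    simp only [covAlong_covAlong_smul hK hF hx hu hV,
      covAlong_smul (differentiableAt_of_contDiffOn hu hF.isOpen hx)
        (differentiableAt_of_contDiffOn hV hF.isOpen hx), smul_add, Finset.sum_add_distrib,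
      sub_smul, Finset.sum_smul, smul_sub, Finset.smul_sum, smul_comm (u x), mul_smul]
    abel
  have hΔ : laplacian G u x • V x = metricTrace (G x) fun i j =>
      (pd i (pd j u) x - ∑ k, christoffel G x k i j * pd k u x) • V x := by
    rw [laplacian_eq_metricTrace, metricTrace_smul]
  have hgrad := sum_grad_smul (G := G) (u := u) (x := x) fun k => covAlong K F V k x
  have hgrad' := hgrad.trans (metricTrace_swap (hG.inv_isSymm hx) fun i j =>
    pd i u x • covAlong K F V j x)
  rw [hΔ, two_smul]
  nth_rw 1 [hgrad]
  rw [hgrad']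
  simp only [roughLaplacian_eq_metricTrace, hleibniz, ← map_smul, ← map_add]
  rfl

theorem fBitension_eq_jacobiOp {f : Coord m → ℝ} (hG : IsMetricOn G s) (hK : IsMetricOn K W)
    (hF : IsSmoothMapOn F s W) (hx : x ∈ s) (hf : ContDiffOn ℝ ∞ f s)
    (hτ : ContDiffOn ℝ ∞ (tension G K F) s) :
    fBitension G K f F x = jacobiOp G K F (fun y => f y • tension G K F y) x := by
  rw [jacobiOp, roughLaplacian_smul hG hK hF hx hf hτ, curvTrace_smul]
  funext a
  simp only [fBitension, bitension_eq_jacobiOp, jacobiOp, Pi.sub_apply, Pi.add_apply,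
    Pi.smul_apply, smul_eq_mul, Finset.sum_apply]
  ring

theorem contDiffOn_tension (hG : IsMetricOn G s) (hK : IsMetricOn K W)
    (hF : IsSmoothMapOn F s W) : ContDiffOn ℝ ∞ (tension G K F) s := by
  have hdF := contDiffOn_dMap hF.isOpen hF.smooth
  simp only [funext fun y => tension_eq_metricTrace (G := G) (K := K) (F := F) (x := y),
    metricTrace_apply]
  exact ContDiffOn.sum fun i _ => ContDiffOn.sum fun j _ => (hG.smooth_inv i j).smul
    ((contDiffOn_covAlong hK hF (hdF j) i).sub
      (ContDiffOn.sum fun k _ => (hG.smooth_christoffel k i j).smul (hdF k)))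

end Jacobi

/-! ### Conformal changes of the metric of the source -/

section Conformal

theorem inv_conformal {ι : Type*} [Fintype ι] [DecidableEq ι] {A B : Matrix ι ι ℝ} {c : ℝ}
    (hc : c ≠ 0) (h : B = c • A) : A⁻¹ = c • B⁻¹ := by
  have hdet : IsUnit B.det ↔ IsUnit A.det := by simp [h, hc]
  by_cases hA : IsUnit A.det
  · rw [h, show c • A = Units.mk0 c hc • A from rfl, Matrix.inv_smul' A (Units.mk0 c hc) hA,
      Units.smul_def, smul_smul, Units.val_inv_eq_inv_val, Units.val_mk0, mul_inv_cancel₀ hc,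
      one_smul]
  · rw [Matrix.nonsing_inv_apply_not_isUnit A hA, Matrix.nonsing_inv_apply_not_isUnit B
      (hdet.not.2 hA), smul_zero]

theorem metricTrace_conformal {m : ℕ} {E : Type*} [AddCommGroup E] [Module ℝ E]
    {A B : Matrix (Fin m) (Fin m) ℝ} {c : ℝ} (hc : c ≠ 0) (h : B = c • A)
    (T : Fin m → Fin m → E) : metricTrace A T = c • metricTrace B T := by
  simp only [metricTrace_apply, inv_conformal hc h, Matrix.smul_apply, Finset.smul_sum,
    smul_assoc]

variable {m n : ℕ} {f : Coord m → ℝ} {G G' : Coord m → Matrix (Fin m) (Fin m) ℝ}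
  {s : Set (Coord m)} {x : Coord m}

theorem christoffel_conformal (hG : IsMetricOn G s) (hx : x ∈ s) (hf : ContDiffOn ℝ ∞ f s)
    (hf0 : f x ≠ 0) (hG' : ∀ y ∈ s, G' y = f y • G y) (k i j : Fin m) :
    christoffel G' x k i j = christoffel G x k i j + 1 / (2 * f x) * ∑ l, (G x)⁻¹ k l *
      (pd i f x * G x j l + pd j f x * G x i l - pd l f x * G x i j) := by
  have hpd (i a b : Fin m) : pd i (fun y => G' y a b) x
      = pd i f x * G x a b + f x * pd i (fun y => G y a b) x := by
    rw [← pd_mul (differentiableAt_of_contDiffOn hf hG.isOpen hx)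
      (differentiableAt_of_contDiffOn (hG.smooth a b) hG.isOpen hx)]
    exact pd_congr hG.isOpen hx fun y hy => by simp [hG' y hy]
  simp only [christoffel, hpd, inv_conformal hf0 (hG' x hx), Matrix.smul_apply, smul_eq_mul,
    Finset.mul_sum, ← Finset.sum_add_distrib]
  refine Finset.sum_congr rfl fun l _ => ?_
  field_simp
  ring

theorem metricTrace_symmetrization (hG : IsMetricOn G s) (hx : x ∈ s) (c : Fin m → ℝ)
    (l : Fin m) : metricTrace (G x) (fun i j => c i * G x j l + c j * G x i l - c l * G x i j)
      = (2 - m) * c l := by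
  have hinv (a b : Fin m) : ∑ j, (G x)⁻¹ a j * G x j b = (1 : Matrix (Fin m) (Fin m) ℝ) a b :=
    congr_fun₂ (hG.inv_mul hx) a b
  have hfst : metricTrace (G x) (fun i j => c i * G x j l) = c l := by
    simp only [metricTrace_apply, smul_eq_mul, mul_left_comm _ (c _), ← Finset.mul_sum, hinv,
      Matrix.one_apply, mul_ite, mul_one, mul_zero, Finset.sum_ite_eq', Finset.mem_univ, if_true]
  have hsnd : metricTrace (G x) (fun i j => c j * G x i l) = c l := by
    rw [← hfst, ← metricTrace_swap (hG.inv_isSymm hx) fun i j => c j * G x i l]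
  have hthd : metricTrace (G x) (fun i j => c l * G x i j) = m * c l := by
    have hinv' (i : Fin m) : ∑ j, (G x)⁻¹ i j * G x i j = 1 := by
      simpa [hG.symm hx i] using hinv i i
    simp only [metricTrace_apply, smul_eq_mul, mul_left_comm _ (c l), ← Finset.mul_sum, hinv']
    simp [mul_comm]
  calc _ = metricTrace (G x) (fun i j => c i * G x j l)
        + metricTrace (G x) (fun i j => c j * G x i l)
        - metricTrace (G x) (fun i j => c l * G x i j) := by rw [← map_add, ← map_sub]; rfl
    _ = _ := by rw [hfst, hsnd, hthd]; ring

theorem metricTrace_christoffel_conformal (hG : IsMetricOn G s) (hx : x ∈ s)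
    (hf : ContDiffOn ℝ ∞ f s) (hf0 : f x ≠ 0) (hG' : ∀ y ∈ s, G' y = f y • G y) (k : Fin m) :
    metricTrace (G x) (christoffel G' x k)
      = metricTrace (G x) (christoffel G x k) + (2 - m) / (2 * f x) * grad G f x k := by
  have hΓ : christoffel G' x k = christoffel G x k + (1 / (2 * f x)) • ∑ l, (G x)⁻¹ k l •
      fun i j => pd i f x * G x j l + pd j f x * G x i l - pd l f x * G x i j := by
    funext i j
    simp [christoffel_conformal hG hx hf hf0 hG', Finset.sum_apply]
  rw [hΓ, map_add, map_smul, map_sum]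
  simp only [map_smul, metricTrace_symmetrization hG hx (fun i => pd i f x), grad, smul_eq_mul,
    Finset.mul_sum]
  congr 1
  exact Finset.sum_congr rfl fun l _ => by ring

end Conformal

section ConformalSurface

variable {n : ℕ} {f : Coord 2 → ℝ} {G G' : Coord 2 → Matrix (Fin 2) (Fin 2) ℝ}
  {K : Coord n → Matrix (Fin n) (Fin n) ℝ} {W : Set (Coord n)}
  {F : Coord 2 → Coord n} {s : Set (Coord 2)} {x : Coord 2}

theorem metricTrace_sub_christoffel_conformal {E : Type*} [AddCommGroup E] [Module ℝ E]
    (hG : IsMetricOn G s) (hx : x ∈ s) (hf : ContDiffOn ℝ ∞ f s) (hf0 : f x ≠ 0)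
    (hG' : ∀ y ∈ s, G' y = f y • G y) (A : Fin 2 → Fin 2 → E) (B : Fin 2 → E) :
    metricTrace (G x) (fun i j => A i j - ∑ k, christoffel G x k i j • B k)
      = f x • metricTrace (G' x) (fun i j => A i j - ∑ k, christoffel G' x k i j • B k) := by
  have htrace (Γ : Fin 2 → Fin 2 → Fin 2 → ℝ) :
      metricTrace (G x) (fun i j => A i j - ∑ k, Γ k i j • B k)
        = metricTrace (G x) A - ∑ k, metricTrace (G x) (Γ k) • B k := by
    simp only [metricTrace_smul, ← map_sum, ← map_sub]
    rfl
  rw [← metricTrace_conformal hf0 (hG' x hx), htrace (christoffel G x), htrace (christoffel G' x)]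
  simp [metricTrace_christoffel_conformal hG hx hf hf0 hG']

theorem bitension_conformal (hG : IsMetricOn G s) (hG'm : IsMetricOn G' s) (hK : IsMetricOn K W)
    (hF : IsSmoothMapOn F s W) (hx : x ∈ s) (hf : ContDiffOn ℝ ∞ f s)
    (hf0 : ∀ y ∈ s, f y ≠ 0) (hG' : ∀ y ∈ s, G' y = f y • G y) :
    bitension G K F x = f x • fBitension G' K f F x := by
  have hτ : Set.EqOn (tension G K F) (fun y => f y • tension G' K F y) s := fun y hy => by
    simp only [tension_eq_metricTrace]
    exact metricTrace_sub_christoffel_conformal hG hy hf (hf0 y hy) hG' _ _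
  rw [bitension_eq_jacobiOp, jacobiOp_congr hF.isOpen hx hτ,
    fBitension_eq_jacobiOp hG'm hK hF hx hf (contDiffOn_tension hG'm hK hF), jacobiOp, jacobiOp,
    smul_sub]
  congr 1
  · simp only [roughLaplacian_eq_metricTrace]
    exact metricTrace_sub_christoffel_conformal hG hx hf (hf0 x hx) hG' _ _
  · exact metricTrace_conformal (hf0 x hx) (hG' x hx) _

end ConformalSurface

/-! ### Isometric immersions -/

section Immersion

/-- `F` is an isometric immersion of `(s, G)` into `(W, K)`; the induced metric `G` is required to
be positive definite, so `F` is an immersion. -/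
structure IsIsometricImmersionOn {m n : ℕ} (G : Coord m → Matrix (Fin m) (Fin m) ℝ)
    (K : Coord n → Matrix (Fin n) (Fin n) ℝ) (F : Coord m → Coord n) (s : Set (Coord m))
    (W : Set (Coord n)) : Prop where
  metric : IsMetricOn K W
  map : IsSmoothMapOn F s W
  source : IsMetricOn G s
  induced : ∀ x ∈ s, ∀ i j, bil (K (F x)) (dMap F i x) (dMap F j x) = G x i j

/-- The part of `V` tangent to the image of `F`, that is `g^{kl} ⟨V, ∂_l F⟩ ∂_k F`. -/
def tangentPart {m n : ℕ} (G : Coord m → Matrix (Fin m) (Fin m) ℝ)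
    (K : Coord n → Matrix (Fin n) (Fin n) ℝ) (F : Coord m → Coord n) (x : Coord m)
    (V : Fin n → ℝ) : Fin n → ℝ :=
  metricTrace (G x) fun k l => bil (K (F x)) V (dMap F l x) • dMap F k x

variable {m n : ℕ} {G : Coord m → Matrix (Fin m) (Fin m) ℝ}
  {K : Coord n → Matrix (Fin n) (Fin n) ℝ} {F : Coord m → Coord n} {s : Set (Coord m)}
  {W : Set (Coord n)} {x : Coord m}

namespace IsIsometricImmersionOn

theorem bil_comm (h : IsIsometricImmersionOn G K F s W) (hx : x ∈ s) (V V' : Fin n → ℝ) :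
    bil (K (F x)) V V' = bil (K (F x)) V' V :=
  BiharmonicSurface.bil_comm (h.metric.isSymm (h.map.mapsTo hx)) V V'

theorem smooth_dMap (h : IsIsometricImmersionOn G K F s W) (i : Fin m) :
    ContDiffOn ℝ ∞ (dMap F i) s :=
  contDiffOn_dMap h.map.isOpen h.map.smooth i

theorem bil_tangentPart (h : IsIsometricImmersionOn G K F s W) (hx : x ∈ s) (V : Fin n → ℝ)
    (j : Fin m) :
    bil (K (F x)) (tangentPart G K F x V) (dMap F j x) = bil (K (F x)) V (dMap F j x) := by
  have hinv (l : Fin m) : ∑ k, (G x)⁻¹ k l * G x k j = (1 : Matrix (Fin m) (Fin m) ℝ) l j := by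
    rw [← h.source.inv_mul hx, Matrix.mul_apply]
    exact Finset.sum_congr rfl fun k _ => by rw [h.source.inv_symm hx]
  calc bil (K (F x)) (tangentPart G K F x V) (dMap F j x)
      = ∑ l, bil (K (F x)) V (dMap F l x) * ∑ k, (G x)⁻¹ k l * G x k j := by
        simp only [tangentPart, metricTrace_apply, map_sum, map_smul, LinearMap.sum_apply,
          LinearMap.smul_apply, smul_eq_mul, h.induced x hx, Finset.mul_sum]
        rw [Finset.sum_comm]
        exact Finset.sum_congr rfl fun l _ => Finset.sum_congr rfl fun k _ => by ring
    _ = bil (K (F x)) V (dMap F j x) := by simp [hinv, Matrix.one_apply]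

-- Koszul's formula.
theorem bil_covAlong_dMap (h : IsIsometricImmersionOn G K F s W) (hx : x ∈ s) (i j l : Fin m) :
    bil (K (F x)) (covAlong K F (dMap F j) i x) (dMap F l x)
      = ∑ k, christoffel G x k i j * G x k l := by
  have hpd (i j l : Fin m) : pd i (fun y => G y j l) x
      = bil (K (F x)) (covAlong K F (dMap F j) i x) (dMap F l x)
        + bil (K (F x)) (covAlong K F (dMap F l) i x) (dMap F j x) := by
    rw [← h.bil_comm hx (dMap F j x),
      ← pd_bil h.metric h.map hx (h.smooth_dMap j) (h.smooth_dMap l)]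
    exact pd_congr h.map.isOpen hx fun y hy => (h.induced y hy j l).symm
  have hcomm (i j : Fin m) := covAlong_dMap_comm (i := i) (j := j) h.metric h.map hx
  have hkoszul := h.source.mul_christoffelMatrix_apply hx l i j
  rw [hpd, hpd, hpd, hcomm j i, hcomm l i, hcomm l j] at hkoszul
  simp only [Matrix.mul_apply, christoffelMatrix, Matrix.of_apply] at hkoszul
  simp only [mul_comm (christoffel G x _ i j), h.source.symm hx _ l, hkoszul]
  ring

end IsIsometricImmersionOn

end Immersion

/-! ### Hypersurfaces -/

section Hypersurface

/-- `F` is an isometric immersion of codimension one with smooth unit normal field `ν`. -/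
structure IsHypersurfaceOn {m n : ℕ} (G : Coord m → Matrix (Fin m) (Fin m) ℝ)
    (K : Coord n → Matrix (Fin n) (Fin n) ℝ) (F : Coord m → Coord n) (ν : Coord m → Fin n → ℝ)
    (s : Set (Coord m)) (W : Set (Coord n)) : Prop extends IsIsometricImmersionOn G K F s W where
  codim : n = m + 1
  smooth : ContDiffOn ℝ ∞ ν s
  unit : ∀ x ∈ s, bil (K (F x)) (ν x) (ν x) = 1
  normal : ∀ x ∈ s, ∀ i, bil (K (F x)) (ν x) (dMap F i x) = 0

/-- The coefficients `b_ij = -⟨∇_i ν, ∂_j F⟩` of the second fundamental form. -/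
def secondForm {m n : ℕ} (K : Coord n → Matrix (Fin n) (Fin n) ℝ) (F : Coord m → Coord n)
    (ν : Coord m → Fin n → ℝ) (x : Coord m) (i j : Fin m) : ℝ :=
  -bil (K (F x)) (covAlong K F ν i x) (dMap F j x)

/-- The covariant derivative `(∇_l T)_ij = ∂_l T_ij - Γ^k_li T_kj - Γ^k_lj T_ik` of a field of
bilinear forms. -/
def covForm {m : ℕ} (G : Coord m → Matrix (Fin m) (Fin m) ℝ) (T : Coord m → Fin m → Fin m → ℝ)
    (l : Fin m) (x : Coord m) (i j : Fin m) : ℝ :=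
  pd l (fun y => T y i j) x - ∑ k, christoffel G x k l i * T x k j
    - ∑ k, christoffel G x k l j * T x i k

theorem metricTrace_eq_trace {m : ℕ} {g : Matrix (Fin m) (Fin m) ℝ} (hg : g⁻¹.IsSymm)
    (T : Fin m → Fin m → ℝ) : metricTrace g T = (g⁻¹ * Matrix.of T).trace := by
  rw [← metricTrace_swap hg]
  simp [metricTrace_apply, Matrix.trace, Matrix.mul_apply]

theorem pd_metricTrace {m : ℕ} {G : Coord m → Matrix (Fin m) (Fin m) ℝ}
    {T : Coord m → Fin m → Fin m → ℝ} {s : Set (Coord m)} {x : Coord m} (hG : IsMetricOn G s)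
    (hx : x ∈ s) (hT : ∀ i j, ContDiffOn ℝ ∞ (fun y => T y i j) s) (l : Fin m) :
    pd l (fun y => metricTrace (G y) (T y)) x = metricTrace (G x) (covForm G T l x) := by
  have dG (i j : Fin m) := differentiableAt_of_contDiffOn (hG.smooth_inv i j) hG.isOpen hx
  have dT (i j : Fin m) : DifferentiableAt ℝ (fun y => Matrix.of (T y) i j) x :=
    differentiableAt_of_contDiffOn (hT i j) hG.isOpen hx
  have dGT (i j : Fin m) : DifferentiableAt ℝ (fun y => ((G y)⁻¹ * Matrix.of (T y)) i j) x := by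
    simp only [Matrix.mul_apply]
    exact DifferentiableAt.fun_sum fun k _ => (dG i k).fun_mul (dT k j)
  have hcov : Matrix.of (covForm G T l x) = pdMat l (fun y => Matrix.of (T y)) x
      - (christoffelMatrix G l x).transpose * Matrix.of (T x)
      - Matrix.of (T x) * christoffelMatrix G l x := by
    ext i j
    simp [covForm, pdMat, Matrix.mul_apply, christoffelMatrix, mul_comm]
  have hcycle : (christoffelMatrix G l x * ((G x)⁻¹ * Matrix.of (T x))).trace
      = ((G x)⁻¹ * (Matrix.of (T x) * christoffelMatrix G l x)).trace := by
    rw [Matrix.trace_mul_comm, mul_assoc]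
  rw [pd_congr hG.isOpen hx fun y hy => metricTrace_eq_trace (hG.inv_isSymm hy) (T y),
    pd_trace dGT, pdMat_mul dG dT, hG.pdMat_inv hx, metricTrace_eq_trace (hG.inv_isSymm hx), hcov]
  simp only [neg_mul, add_mul, mul_sub, Matrix.trace_add, Matrix.trace_sub,
    Matrix.trace_neg, hcycle, mul_assoc]
  ring

variable {m n : ℕ} {G : Coord m → Matrix (Fin m) (Fin m) ℝ}
  {K : Coord n → Matrix (Fin n) (Fin n) ℝ} {F : Coord m → Coord n} {ν : Coord m → Fin n → ℝ}
  {s : Set (Coord m)} {W : Set (Coord n)} {x : Coord m} {u : Coord m → ℝ}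

theorem bil_covAlong_eq_secondForm (ν : Coord m → Fin n → ℝ) (i j : Fin m) :
    bil (K (F x)) (covAlong K F ν i x) (dMap F j x) = -secondForm K F ν x i j := by
  simp [secondForm]

theorem shape_eq_sum_secondForm (k i : Fin m) :
    shape G K F ν x k i = ∑ j, (G x)⁻¹ k j * secondForm K F ν x i j := by
  simp only [shape, secondForm, bil_apply, mul_neg, Finset.sum_neg_distrib]

theorem natCast_mul_meanCurvature :
    m * meanCurvature G K F ν x = metricTrace (G x) (secondForm K F ν x) := by
  obtain rfl | hm := eq_or_ne m 0
  · simp [metricTrace_apply]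
  · have : (m : ℝ) ≠ 0 := Nat.cast_ne_zero.2 hm
    simp only [meanCurvature, shape_eq_sum_secondForm, metricTrace_apply, smul_eq_mul]
    field_simp

namespace IsHypersurfaceOn

theorem normal_right (h : IsHypersurfaceOn G K F ν s W) (hx : x ∈ s) (i : Fin m) :
    bil (K (F x)) (dMap F i x) (ν x) = 0 := by
  rw [h.bil_comm hx, h.normal x hx]

-- A tangent frame together with the normal is a basis, by a dimension count.
theorem exists_eq_sum_add_smul (h : IsHypersurfaceOn G K F ν s W) (hx : x ∈ s) (Z : Fin n → ℝ) :
    ∃ (a : Fin m → ℝ) (t : ℝ), Z = ∑ k, a k • dMap F k x + t • ν x := by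
  let L : (Fin m → ℝ) × ℝ →ₗ[ℝ] Fin n → ℝ :=
    (Fintype.linearCombination ℝ fun k => dMap F k x).coprod (LinearMap.toSpanSingleton ℝ _ (ν x))
  have hL (p : (Fin m → ℝ) × ℝ) : L p = ∑ k, p.1 k • dMap F k x + p.2 • ν x := by
    simp [L, Fintype.linearCombination_apply]
  have hinj : Function.Injective L := by
    refine (injective_iff_map_eq_zero L).2 fun p hp => ?_
    rw [hL] at hp
    have hν := congr_arg (fun V => bil (K (F x)) V (ν x)) hp
    have hF := congr_arg (fun V => bil (K (F x)) V (∑ k, p.1 k • dMap F k x)) hp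
    simp only [map_add, map_smul, map_sum, LinearMap.add_apply, LinearMap.smul_apply,
      LinearMap.sum_apply, h.normal_right hx, h.normal x hx, h.unit x hx, map_zero,
      LinearMap.zero_apply, mul_zero, Finset.sum_const_zero, zero_add, add_zero, smul_eq_mul,
      mul_one, h.induced x hx] at hν hF
    refine Prod.ext (by_contra fun hp1 => ?_) hν
    refine (bil_pos (h.source.posDef x hx) hp1).ne' ?_
    rw [bil_apply, ← hF]
    exact Finset.sum_congr rfl fun k _ => by
      rw [Finset.mul_sum]
      exact Finset.sum_congr rfl fun l _ => by rw [h.source.symm hx k l]; ring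
  have hdim : Module.finrank ℝ ((Fin m → ℝ) × ℝ) = Module.finrank ℝ (Fin n → ℝ) := by
    simp [h.codim]
  obtain ⟨p, hp⟩ := (LinearMap.injective_iff_surjective_of_finrank_eq_finrank hdim).1 hinj Z
  exact ⟨p.1, p.2, by rw [← hp, hL]⟩

theorem eq_zero_of_bil_eq_zero (h : IsHypersurfaceOn G K F ν s W) (hx : x ∈ s) {Z : Fin n → ℝ}
    (hF : ∀ j, bil (K (F x)) Z (dMap F j x) = 0) (hν : bil (K (F x)) Z (ν x) = 0) : Z = 0 := by
  obtain ⟨a, t, hZ⟩ := h.exists_eq_sum_add_smul hx Z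
  by_contra hne
  refine (bil_pos (h.metric.posDef _ (h.map.mapsTo hx)) hne).ne' ?_
  nth_rw 2 [hZ]
  simp [hF, hν]

theorem eq_tangentPart_add_normalPart (h : IsHypersurfaceOn G K F ν s W) (hx : x ∈ s)
    (Z : Fin n → ℝ) : Z = tangentPart G K F x Z + bil (K (F x)) Z (ν x) • ν x := by
  refine sub_eq_zero.1 (h.eq_zero_of_bil_eq_zero hx (fun j => ?_) ?_)
  · simp [h.bil_tangentPart hx, h.normal x hx]
  · simp [tangentPart, metricTrace_apply, h.normal_right hx, h.unit x hx]

theorem trace_eq (h : IsHypersurfaceOn G K F ν s W) (hx : x ∈ s) (T : Module.End ℝ (Fin n → ℝ)) :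
    LinearMap.trace ℝ _ T
      = metricTrace (G x) (fun i j => bil (K (F x)) (T (dMap F i x)) (dMap F j x))
        + bil (K (F x)) (T (ν x)) (ν x) := by
  have hT : T = metricTrace (G x)
        (fun i j => ((bil (K (F x))).flip (dMap F j x)).smulRight (T (dMap F i x)))
      + ((bil (K (F x))).flip (ν x)).smulRight (T (ν x)) := by
    refine LinearMap.ext fun Z => ?_
    nth_rw 1 [h.eq_tangentPart_add_normalPart hx Z]
    simp [tangentPart, metricTrace_apply]
  nth_rw 1 [hT]
  rw [map_add, map_metricTrace]
  simp only [LinearMap.trace_smulRight, LinearMap.flip_apply]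

theorem ric_eq (h : IsHypersurfaceOn G K F ν s W) (hx : x ∈ s) (X Y : Fin n → ℝ) :
    ric K (F x) X Y
      = metricTrace (G x) (fun i j => bil (K (F x)) (curv K (F x) (dMap F i x) X Y) (dMap F j x))
        + bil (K (F x)) (curv K (F x) (ν x) X Y) (ν x) := by
  rw [ric_eq_trace, h.trace_eq hx]
  rfl

theorem bil_covAlong_normal (h : IsHypersurfaceOn G K F ν s W) (hx : x ∈ s) (i : Fin m) :
    bil (K (F x)) (covAlong K F ν i x) (ν x) = 0 := by
  have hpd := pd_bil (i := i) h.metric h.map hx h.smooth h.smooth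
  rw [pd_congr h.map.isOpen hx h.unit, pd_const, h.bil_comm hx (ν x)] at hpd
  linarith

theorem weingarten (h : IsHypersurfaceOn G K F ν s W) (hx : x ∈ s) (i : Fin m) :
    covAlong K F ν i x = -∑ k, shape G K F ν x k i • dMap F k x := by
  rw [h.eq_tangentPart_add_normalPart hx (covAlong K F ν i x), h.bil_covAlong_normal hx]
  simp only [tangentPart, metricTrace_apply, bil_covAlong_eq_secondForm, shape_eq_sum_secondForm,
    Finset.sum_smul, smul_smul, neg_smul, smul_neg, Finset.sum_neg_distrib, zero_smul, add_zero]

theorem bil_covAlong_dMap_normal (h : IsHypersurfaceOn G K F ν s W) (hx : x ∈ s) (i j : Fin m) :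
    bil (K (F x)) (covAlong K F (dMap F j) i x) (ν x) = secondForm K F ν x i j := by
  have hpd := pd_bil (i := i) h.metric h.map hx h.smooth (h.smooth_dMap j)
  rw [pd_congr h.map.isOpen hx fun y hy => h.normal y hy j, pd_const, h.bil_comm hx (ν x),
    bil_covAlong_eq_secondForm] at hpd
  linarith

theorem secondForm_symm (h : IsHypersurfaceOn G K F ν s W) (hx : x ∈ s) (i j : Fin m) :
    secondForm K F ν x i j = secondForm K F ν x j i := by
  rw [← h.bil_covAlong_dMap_normal hx, covAlong_dMap_comm h.metric h.map hx,
    h.bil_covAlong_dMap_normal hx]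

theorem gauss (h : IsHypersurfaceOn G K F ν s W) (hx : x ∈ s) (i j : Fin m) :
    covAlong K F (dMap F j) i x
      = ∑ k, christoffel G x k i j • dMap F k x + secondForm K F ν x i j • ν x := by
  refine sub_eq_zero.1 (h.eq_zero_of_bil_eq_zero hx (fun l => ?_) ?_)
  · simp [h.bil_covAlong_dMap hx, h.induced x hx, h.normal x hx]
  · simp [h.bil_covAlong_dMap_normal hx, h.normal_right hx, h.unit x hx]

theorem tension_eq (h : IsHypersurfaceOn G K F ν s W) (hx : x ∈ s) :
    tension G K F x = (m * meanCurvature G K F ν x) • ν x := by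
  simp only [tension_eq_metricTrace, natCast_mul_meanCurvature, metricTrace_smul, h.gauss hx,
    add_sub_cancel_left]

theorem smooth_secondForm (h : IsHypersurfaceOn G K F ν s W) (i j : Fin m) :
    ContDiffOn ℝ ∞ (fun y => secondForm K F ν y i j) s :=
  (contDiffOn_bil h.metric h.map (contDiffOn_covAlong h.metric h.map h.smooth i)
    (h.smooth_dMap j)).neg

theorem smooth_meanCurvature (h : IsHypersurfaceOn G K F ν s W) :
    ContDiffOn ℝ ∞ (meanCurvature G K F ν) s := by
  refine contDiffOn_const.mul ?_
  simp only [shape_eq_sum_secondForm]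
  exact ContDiffOn.sum fun i _ => ContDiffOn.sum fun j _ =>
    (h.source.smooth_inv i j).mul (h.smooth_secondForm i j)

end IsHypersurfaceOn

end Hypersurface

/-! ### The Jacobi operator on normal fields of a hypersurface -/

section NormalFields

variable {m n : ℕ} {G : Coord m → Matrix (Fin m) (Fin m) ℝ}
  {K : Coord n → Matrix (Fin n) (Fin n) ℝ} {F : Coord m → Coord n} {ν : Coord m → Fin n → ℝ}
  {s : Set (Coord m)} {W : Set (Coord n)} {x : Coord m} {u f : Coord m → ℝ}

theorem jacobiOp_const_smul {V : Coord m → Fin n → ℝ} (hG : IsMetricOn G s) (hK : IsMetricOn K W)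
    (hF : IsSmoothMapOn F s W) (hx : x ∈ s) (hV : ContDiffOn ℝ ∞ V s) (c : ℝ) :
    jacobiOp G K F (fun y => c • V y) x = c • jacobiOp G K F V x := by
  have hpd (i : Fin m) : pd i (fun _ => c) = fun _ => 0 := funext fun _ => pd_const c
  simp [jacobiOp, roughLaplacian_smul hG hK hF hx contDiffOn_const hV, curvTrace_smul, smul_sub,
    laplacian, grad, hpd, pd_const]

namespace IsHypersurfaceOn

theorem bil_covAlong_covAlong_normal (h : IsHypersurfaceOn G K F ν s W) (hx : x ∈ s)
    (i j : Fin m) : bil (K (F x)) (covAlong K F (covAlong K F ν j) i x) (ν x)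
      = -bil (K (F x)) (covAlong K F ν i x) (covAlong K F ν j x) := by
  have hpd := pd_bil (i := i) h.metric h.map hx (contDiffOn_covAlong h.metric h.map h.smooth j)
    h.smooth
  rw [pd_congr h.map.isOpen hx fun y hy => h.bil_covAlong_normal hy j, pd_const,
    h.bil_comm hx (covAlong K F ν j x)] at hpd
  linarith

theorem bil_covAlong_covAlong_dMap (h : IsHypersurfaceOn G K F ν s W) (hx : x ∈ s)
    (i j l : Fin m) : bil (K (F x)) (covAlong K F (covAlong K F ν j) i x) (dMap F l x)
      = ∑ k, christoffel G x k i l * secondForm K F ν x j k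
        - pd i (fun y => secondForm K F ν y j l) x := by
  have hpd := pd_bil (i := i) h.metric h.map hx (contDiffOn_covAlong h.metric h.map h.smooth j)
    (h.smooth_dMap l)
  simp only [bil_covAlong_eq_secondForm ν, pd_neg, h.gauss hx, map_add, map_sum, map_smul,
    h.bil_covAlong_normal hx, smul_eq_mul, mul_zero, add_zero, mul_neg,
    Finset.sum_neg_distrib] at hpd
  linarith

theorem bil_hessian_normal (h : IsHypersurfaceOn G K F ν s W) (hx : x ∈ s) (i j l : Fin m) :
    bil (K (F x)) (covAlong K F (covAlong K F ν j) i x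
        - ∑ k, christoffel G x k i j • covAlong K F ν k x) (dMap F l x)
      = -covForm G (secondForm K F ν) i x j l := by
  simp only [map_sub, map_sum, map_smul, LinearMap.sub_apply, LinearMap.sum_apply,
    LinearMap.smul_apply, h.bil_covAlong_covAlong_dMap hx, bil_covAlong_eq_secondForm, covForm,
    smul_eq_mul, mul_neg, Finset.sum_neg_distrib]
  ring

theorem covForm_secondForm_symm (h : IsHypersurfaceOn G K F ν s W) (hx : x ∈ s) (i j l : Fin m) :
    covForm G (secondForm K F ν) i x j l = covForm G (secondForm K F ν) i x l j := by
  simp only [covForm, pd_congr h.map.isOpen hx fun _ hy => h.secondForm_symm hy j l,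
    h.secondForm_symm hx _ l, h.secondForm_symm hx j]
  ring

theorem codazzi (h : IsHypersurfaceOn G K F ν s W) (hx : x ∈ s) (i j l : Fin m) :
    covForm G (secondForm K F ν) l x i j - covForm G (secondForm K F ν) i x l j
      = bil (K (F x)) (curv K (F x) (dMap F i x) (dMap F l x) (ν x)) (dMap F j x) := by
  rw [← covAlong_covAlong_sub h.metric h.map hx h.smooth, map_sub, LinearMap.sub_apply,
    h.bil_covAlong_covAlong_dMap hx, h.bil_covAlong_covAlong_dMap hx]
  simp only [covForm, h.source.christoffel_symm hx _ l i]
  ring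

theorem bil_curvTrace_normal (h : IsHypersurfaceOn G K F ν s W) (hx : x ∈ s) (X : Fin n → ℝ) :
    bil (K (F x)) (curvTrace G K F x (ν x)) X = -ric K (F x) (ν x) X := by
  have hdiag : curv K (F x) (ν x) (ν x) = 0 :=
    LinearMap.ext fun Z => self_eq_neg.1 (LinearMap.congr_fun (curv_antisymm _ _) Z)
  rw [h.ric_eq hx, hdiag, LinearMap.zero_apply, map_zero, LinearMap.zero_apply, add_zero,
    ← LinearMap.flip_apply, curvTrace, map_metricTrace]
  simp only [LinearMap.flip_apply, h.metric.bil_curv_antisymm (h.map.mapsTo hx) _ _ _ X]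
  exact map_neg (metricTrace (G x)) _

theorem metricTrace_bil_curv (h : IsHypersurfaceOn G K F ν s W) (hx : x ∈ s) (l : Fin m) :
    metricTrace (G x) (fun i j =>
        bil (K (F x)) (curv K (F x) (dMap F i x) (dMap F l x) (ν x)) (dMap F j x))
      = ric K (F x) (ν x) (dMap F l x) := by
  rw [neg_eq_iff_eq_neg.1 (h.bil_curvTrace_normal hx (dMap F l x)).symm, ← LinearMap.flip_apply,
    curvTrace, map_metricTrace, ← metricTrace_swap (h.source.inv_isSymm hx), ← map_neg]
  congr 1
  funext i j
  rw [h.metric.bil_curv_pair (h.map.mapsTo hx), curv_antisymm]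
  simp

theorem pd_natCast_mul_meanCurvature (h : IsHypersurfaceOn G K F ν s W) (hx : x ∈ s)
    (l : Fin m) : m * pd l (meanCurvature G K F ν) x
      = metricTrace (G x) (covForm G (secondForm K F ν) l x) := by
  rw [← pd_metricTrace h.source hx h.smooth_secondForm]
  simp only [← natCast_mul_meanCurvature]
  rw [pd_mul (differentiableAt_const _)
    (differentiableAt_of_contDiffOn h.smooth_meanCurvature h.map.isOpen hx), pd_const, zero_mul,
    zero_add]

-- The traced Codazzi equation.
theorem bil_roughLaplacian_dMap (h : IsHypersurfaceOn G K F ν s W) (hx : x ∈ s) (l : Fin m) :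
    bil (K (F x)) (roughLaplacian G K F ν x) (dMap F l x)
      = ric K (F x) (ν x) (dMap F l x) - m * pd l (meanCurvature G K F ν) x := by
  rw [← LinearMap.flip_apply, roughLaplacian_eq_metricTrace, map_metricTrace,
    ← h.metricTrace_bil_curv hx, h.pd_natCast_mul_meanCurvature hx, ← map_sub]
  congr 1
  funext i j
  rw [LinearMap.flip_apply, h.bil_hessian_normal hx, h.covForm_secondForm_symm hx, Pi.sub_apply,
    Pi.sub_apply, ← h.codazzi hx]
  ring

theorem bil_roughLaplacian_normal (h : IsHypersurfaceOn G K F ν s W) (hx : x ∈ s) :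
    bil (K (F x)) (roughLaplacian G K F ν x) (ν x) = -shapeNormSq G K F ν x := by
  have hbil (i j : Fin m) : bil (K (F x)) (covAlong K F ν i x) (covAlong K F ν j x)
      = ∑ k, ∑ l, G x k l * shape G K F ν x k i * shape G K F ν x l j := by
    simp only [h.weingarten hx, map_neg, LinearMap.neg_apply, map_sum, map_smul,
      LinearMap.sum_apply, LinearMap.smul_apply, h.induced x hx, smul_eq_mul, mul_neg,
      Finset.sum_neg_distrib, neg_neg, Finset.mul_sum]
    rw [Finset.sum_comm]
    exact Finset.sum_congr rfl fun k _ => Finset.sum_congr rfl fun l _ => by ring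
  rw [← LinearMap.flip_apply, roughLaplacian_eq_metricTrace, map_metricTrace]
  simp only [LinearMap.flip_apply, map_sub, map_sum, map_smul,
    h.bil_covAlong_covAlong_normal hx, h.bil_covAlong_normal hx, mul_zero, Finset.sum_const_zero,
    sub_zero, hbil, metricTrace_apply, smul_eq_mul, mul_neg, Finset.sum_neg_distrib, shapeNormSq,
    Finset.mul_sum, mul_assoc]

theorem jacobiOp_smul_normal (h : IsHypersurfaceOn G K F ν s W) (hx : x ∈ s)
    (hu : ContDiffOn ℝ ∞ u s) : jacobiOp G K F (fun y => u y • ν y) x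
      = u x • roughLaplacian G K F ν x + laplacian G u x • ν x
        + (2 : ℝ) • ∑ k, grad G u x k • covAlong K F ν k x - u x • curvTrace G K F x (ν x) := by
  rw [jacobiOp, roughLaplacian_smul h.source h.metric h.map hx hu h.smooth, curvTrace_smul]

theorem bil_jacobiOp_smul_normal (h : IsHypersurfaceOn G K F ν s W) (hx : x ∈ s)
    (hu : ContDiffOn ℝ ∞ u s) :
    bil (K (F x)) (jacobiOp G K F (fun y => u y • ν y) x) (ν x) = laplacian G u x
      - u x * (shapeNormSq G K F ν x - ric K (F x) (ν x) (ν x)) := by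
  simp only [h.jacobiOp_smul_normal hx hu, map_add, map_sub, map_smul, map_sum,
    LinearMap.add_apply, LinearMap.sub_apply, LinearMap.smul_apply, LinearMap.sum_apply,
    h.bil_roughLaplacian_normal hx, h.unit x hx, h.bil_covAlong_normal hx,
    h.bil_curvTrace_normal hx, smul_eq_mul, mul_zero, Finset.sum_const_zero]
  ring

theorem bil_jacobiOp_smul_dMap (h : IsHypersurfaceOn G K F ν s W) (hx : x ∈ s)
    (hu : ContDiffOn ℝ ∞ u s) (l : Fin m) :
    bil (K (F x)) (jacobiOp G K F (fun y => u y • ν y) x) (dMap F l x)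
      = -(2 * ∑ k, secondForm K F ν x k l * grad G u x k
        + u x * (m * pd l (meanCurvature G K F ν) x
          - 2 * ric K (F x) (ν x) (dMap F l x))) := by
  simp only [h.jacobiOp_smul_normal hx hu, map_add, map_sub, map_smul, map_sum,
    LinearMap.add_apply, LinearMap.sub_apply, LinearMap.smul_apply, LinearMap.sum_apply,
    h.bil_roughLaplacian_dMap hx, h.normal x hx, bil_covAlong_eq_secondForm,
    h.bil_curvTrace_normal hx, smul_eq_mul, mul_zero, mul_neg, neg_mul, Finset.sum_neg_distrib,
    mul_comm (grad G u x _)]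
  ring

theorem jacobiOp_smul_eq_zero_iff (h : IsHypersurfaceOn G K F ν s W) (hx : x ∈ s)
    (hu : ContDiffOn ℝ ∞ u s) : jacobiOp G K F (fun y => u y • ν y) x = 0 ↔
      laplacian G u x - u x * (shapeNormSq G K F ν x - ric K (F x) (ν x) (ν x)) = 0 ∧
      ∀ l, 2 * ∑ k, secondForm K F ν x k l * grad G u x k
        + u x * (m * pd l (meanCurvature G K F ν) x
          - 2 * ric K (F x) (ν x) (dMap F l x)) = 0 := by
  rw [← h.bil_jacobiOp_smul_normal hx hu]
  refine ⟨fun hJ => ⟨by simp [hJ], fun l => ?_⟩,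
    fun hJ => h.eq_zero_of_bil_eq_zero hx (fun l => ?_) hJ.1⟩
  · rw [← neg_eq_zero, ← h.bil_jacobiOp_smul_dMap hx hu, hJ, map_zero, LinearMap.zero_apply]
  · rw [h.bil_jacobiOp_smul_dMap hx hu, hJ.2 l, neg_zero]

theorem fBitension_eq (h : IsHypersurfaceOn G K F ν s W) (hx : x ∈ s)
    (hf : ContDiffOn ℝ ∞ f s) : fBitension G K f F x
      = (m : ℝ) • jacobiOp G K F (fun y => (f y * meanCurvature G K F ν y) • ν y) x := by
  have hτ : Set.EqOn (fun y => f y • tension G K F y)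
      (fun y => (m : ℝ) • (f y * meanCurvature G K F ν y) • ν y) s := fun y hy => by
    simp only [h.tension_eq hy, smul_smul]
    congr 1
    ring
  rw [fBitension_eq_jacobiOp h.source h.metric h.map hx hf
      (contDiffOn_tension h.source h.metric h.map), jacobiOp_congr h.map.isOpen hx hτ]
  exact jacobiOp_const_smul h.source h.metric h.map hx
    ((hf.mul h.smooth_meanCurvature).smul h.smooth) m

end IsHypersurfaceOn

end NormalFields

section Surface

variable {n : ℕ} {G : Coord 2 → Matrix (Fin 2) (Fin 2) ℝ}
  {K : Coord n → Matrix (Fin n) (Fin n) ℝ} {F : Coord 2 → Coord n} {ν : Coord 2 → Fin n → ℝ}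
  {s : Set (Coord 2)} {W : Set (Coord n)} {x : Coord 2} {f : Coord 2 → ℝ}

theorem IsHypersurfaceOn.fBitension_eq_zero_iff (h : IsHypersurfaceOn G K F ν s W) (hx : x ∈ s)
    (hf : ContDiffOn ℝ ∞ f s) : fBitension G K f F x = 0 ↔ SystemAt G K f F ν x := by
  let u : Coord 2 → ℝ := fun y => f y * meanCurvature G K F ν y
  let Z (l : Fin 2) : ℝ := ∑ i, secondForm K F ν x i l * grad G u x i
    + u x * (pd l (meanCurvature G K F ν) x - ric K (F x) (ν x) (dMap F l x))
  have hric : ricciNormal K F ν x = ric K (F x) (ν x) (ν x) := (bil_apply _ _ _).symm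
  have hsharp (k : Fin 2) : ∑ i, shape G K F ν x k i * grad G u x i
      + u x * (grad G (meanCurvature G K F ν) x k - ricciTangent G K F ν x k)
      = (G x)⁻¹.mulVec Z k := by
    simp only [shape_eq_sum_secondForm, ricciTangent, grad, Z, Matrix.mulVec, dotProduct, ric,
      bil_apply, Matrix.of_apply, Fin.sum_univ_two]
    ring
  have hinj : (G x)⁻¹.mulVec Z = 0 ↔ Z = 0 := by
    refine ⟨fun hZ => ?_, fun hZ => by rw [hZ, Matrix.mulVec_zero]⟩
    rw [← Matrix.one_mulVec Z, ← h.source.mul_inv hx, ← Matrix.mulVec_mulVec, hZ,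
      Matrix.mulVec_zero]
  rw [h.fBitension_eq hx hf, smul_eq_zero_iff_right (by norm_num),
    h.jacobiOp_smul_eq_zero_iff hx (hf.mul h.smooth_meanCurvature), SystemAt, hric]
  refine and_congr_right' ?_
  have hZ : (∀ k, (G x)⁻¹.mulVec Z k = 0) ↔ ∀ l, Z l = 0 :=
    funext_iff.symm.trans (hinj.trans funext_iff)
  simp only [u] at hsharp
  simp only [hsharp, hZ]
  refine forall_congr' fun l => ?_
  rw [← mul_eq_zero_iff_left (two_ne_zero (α := ℝ)) (b := Z l)]
  simp only [Z, u]
  push_cast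
  ring_nf

end Surface

/-! ### Local unit normal fields -/

section LocalNormal

variable {m n : ℕ} {G : Coord m → Matrix (Fin m) (Fin m) ℝ}
  {K : Coord n → Matrix (Fin n) (Fin n) ℝ} {F : Coord m → Coord n} {s s' : Set (Coord m)}
  {W : Set (Coord n)} {x : Coord m}

theorem IsMetricOn.mono (hG : IsMetricOn G s) (hs' : IsOpen s') (h : s' ⊆ s) : IsMetricOn G s' :=
  ⟨hs', fun a b => (hG.smooth a b).mono h, fun y hy => hG.posDef y (h hy)⟩

theorem IsSmoothMapOn.mono (hF : IsSmoothMapOn F s W) (hs' : IsOpen s') (h : s' ⊆ s) :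
    IsSmoothMapOn F s' W :=
  ⟨hs', hF.smooth.mono h, hF.mapsTo.mono_left h⟩

theorem posDef_of_bil_pos {B : Matrix (Fin n) (Fin n) ℝ} (hB : B.IsSymm)
    (hpos : ∀ v : Fin n → ℝ, v ≠ 0 → 0 < bil B v v) : B.PosDef := by
  refine Matrix.PosDef.of_dotProduct_mulVec_pos (Matrix.IsHermitian.ext fun i j => ?_)
    fun v hv => ?_
  · simpa using hB.apply i j
  · rw [star_trivial, ← bil_eq_dotProduct_mulVec]
    exact hpos v hv

theorem exists_sub_tangentPart_ne_zero (G : Coord m → Matrix (Fin m) (Fin m) ℝ)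
    (K : Coord n → Matrix (Fin n) (Fin n) ℝ) (F : Coord m → Coord n) (hmn : m < n) (x : Coord m) :
    ∃ c : Fin n → ℝ, c - tangentPart G K F x c ≠ 0 := by
  let T : Submodule ℝ (Fin n → ℝ) := Submodule.span ℝ (Set.range fun i => dMap F i x)
  have hT : T ≠ ⊤ := fun htop => by
    have hrank : Module.finrank ℝ T ≤ m := by
      simpa [Set.finrank] using finrank_range_le_card (R := ℝ) fun i => dMap F i x
    rw [htop, finrank_top, Module.finrank_fin_fun] at hrank
    exact hrank.not_gt hmn
  obtain ⟨c, hc⟩ := SetLike.exists_not_mem_of_ne_top T hT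
  refine ⟨c, fun h0 => hc ?_⟩
  rw [sub_eq_zero.1 h0, tangentPart, metricTrace_apply]
  exact T.sum_mem fun k _ => T.sum_mem fun l _ => T.smul_mem _
    (T.smul_mem _ (Submodule.subset_span ⟨k, rfl⟩))

namespace IsIsometricImmersionOn

theorem mono (h : IsIsometricImmersionOn G K F s W) (hs' : IsOpen s') (hsub : s' ⊆ s) :
    IsIsometricImmersionOn G K F s' W :=
  ⟨h.metric, h.map.mono hs' hsub, h.source.mono hs' hsub, fun x hx => h.induced x (hsub hx)⟩

theorem of_linearIndependent (hK : IsMetricOn K W) (hF : IsSmoothMapOn F s W)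
    (hli : ∀ x ∈ s, LinearIndependent ℝ fun i => dMap F i x)
    (hG : ∀ x ∈ s, ∀ i j, bil (K (F x)) (dMap F i x) (dMap F j x) = G x i j) :
    IsIsometricImmersionOn G K F s W := by
  have hd (i : Fin m) := contDiffOn_dMap hF.isOpen hF.smooth i
  refine ⟨hK, hF, ⟨hF.isOpen, fun i j => ?_, fun x hx => posDef_of_bil_pos ?_ fun v hv => ?_⟩, hG⟩
  · exact (contDiffOn_bil hK hF (hd i) (hd j)).congr fun x hx => (hG x hx i j).symm
  · exact Matrix.IsSymm.ext fun i j => by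
      rw [← hG x hx, ← hG x hx, BiharmonicSurface.bil_comm (hK.isSymm (hF.mapsTo hx))]
  · have hgram : bil (G x) v v
        = bil (K (F x)) (∑ i, v i • dMap F i x) (∑ i, v i • dMap F i x) := by
      simp only [bil_apply (G x), ← hG x hx, map_sum, map_smul, LinearMap.sum_apply,
        LinearMap.smul_apply, smul_eq_mul, Finset.mul_sum]
      rw [Finset.sum_comm]
      exact Finset.sum_congr rfl fun i _ => Finset.sum_congr rfl fun j _ => by ring
    rw [hgram]
    exact bil_pos (hK.posDef _ (hF.mapsTo hx)) fun h0 =>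
      hv (funext (Fintype.linearIndependent_iff.1 (hli x hx) v h0))

theorem contDiffOn_tangentPart (h : IsIsometricImmersionOn G K F s W) {V : Coord m → Fin n → ℝ}
    (hV : ContDiffOn ℝ ∞ V s) : ContDiffOn ℝ ∞ (fun y => tangentPart G K F y (V y)) s := by
  simp only [tangentPart, metricTrace_apply]
  exact ContDiffOn.sum fun k _ => ContDiffOn.sum fun l _ => (h.source.smooth_inv k l).smul
    ((contDiffOn_bil h.metric h.map hV (h.smooth_dMap l)).smul (h.smooth_dMap k))

theorem isHypersurfaceOn_normalize (h : IsIsometricImmersionOn G K F s W) (hn : n = m + 1)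
    {w : Coord m → Fin n → ℝ} (hw : ContDiffOn ℝ ∞ w s)
    (hpos : ∀ x ∈ s, 0 < bil (K (F x)) (w x) (w x))
    (hnormal : ∀ x ∈ s, ∀ i, bil (K (F x)) (w x) (dMap F i x) = 0) :
    IsHypersurfaceOn G K F (fun x => (√(bil (K (F x)) (w x) (w x)))⁻¹ • w x) s W where
  toIsIsometricImmersionOn := h
  codim := hn
  smooth := (((contDiffOn_bil h.metric h.map hw hw).sqrt fun x hx => (hpos x hx).ne').inv
    fun x hx => (Real.sqrt_pos.2 (hpos x hx)).ne').smul hw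
  unit x hx := by
    have hsqrt := Real.mul_self_sqrt (hpos x hx).le
    have hsqrt0 := (Real.sqrt_pos.2 (hpos x hx)).ne'
    simp only [map_smul, LinearMap.smul_apply, smul_eq_mul]
    field_simp
    linarith
  normal x hx i := by simp [hnormal x hx i]

theorem exists_isHypersurfaceOn (h : IsIsometricImmersionOn G K F s W) (hn : n = m + 1)
    (hx : x ∈ s) : ∃ s' ⊆ s, ∃ ν, x ∈ s' ∧ IsHypersurfaceOn G K F ν s' W := by
  obtain ⟨c, hc⟩ := exists_sub_tangentPart_ne_zero G K F (by omega) x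
  let w : Coord m → Fin n → ℝ := fun y => c - tangentPart G K F y c
  have hw : ContDiffOn ℝ ∞ w s := contDiffOn_const.sub (h.contDiffOn_tangentPart contDiffOn_const)
  let s' : Set (Coord m) := s ∩ (fun y => bil (K (F y)) (w y) (w y)) ⁻¹' Set.Ioi 0
  have hs' : IsOpen s' := (contDiffOn_bil h.metric h.map hw hw).continuousOn.isOpen_inter_preimage
    h.map.isOpen isOpen_Ioi
  refine ⟨s', Set.inter_subset_left, _, ⟨hx, bil_pos (h.metric.posDef _ (h.map.mapsTo hx)) hc⟩,
    (h.mono hs' Set.inter_subset_left).isHypersurfaceOn_normalize hn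
      (hw.mono Set.inter_subset_left) (fun y hy => hy.2) fun y hy i => ?_⟩
  rw [map_sub, LinearMap.sub_apply, h.bil_tangentPart hy.1, sub_self]

end IsIsometricImmersionOn

end LocalNormal

/-! ### Tangent vectors in charts -/

section Charts

variable {k m : ℕ}
variable {M : Type*} [TopologicalSpace M] [ChartedSpace (Coord m) M]
variable {Q : Type*} [TopologicalSpace Q] [ChartedSpace (Coord k) Q]
variable {e : OpenPartialHomeomorph M (Coord m)}

/-- The components, in the chart `e`, of a tangent vector `v` at `p`. -/
def components (e : OpenPartialHomeomorph M (Coord m)) (p : M) (v : TangentSpace (𝓡 m) p) :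
    Fin m → ℝ :=
  fun i => (show Coord m from mfderiv (𝓡 m) (𝓡 m) e p v) i

theorem mdifferentiable_chart (he : e ∈ IsManifold.maximalAtlas (𝓡 m) ∞ M) :
    e.MDifferentiable (𝓡 m) (𝓡 m) :=
  ⟨(contMDiffOn_of_mem_maximalAtlas he).mdifferentiableOn (by simp),
    (contMDiffOn_symm_of_mem_maximalAtlas he).mdifferentiableOn (by simp)⟩

theorem components_mfderiv_symm (he : e ∈ IsManifold.maximalAtlas (𝓡 m) ∞ M) {x : Coord m}
    (hx : x ∈ e.target) (v : Coord m) :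
    components e (e.symm x) (mfderiv (𝓡 m) (𝓡 m) e.symm x v) = v :=
  congrArg (fun (L : Coord m →L[ℝ] Coord m) i => L v i)
    ((mdifferentiable_chart he).symm.symm_comp_deriv (x := x) hx)

theorem mfderiv_symm_components (he : e ∈ IsManifold.maximalAtlas (𝓡 m) ∞ M) {x : Coord m}
    (hx : x ∈ e.target) (v : TangentSpace (𝓡 m) (e.symm x)) :
    mfderiv (𝓡 m) (𝓡 m) e.symm x (WithLp.toLp 2 (components e (e.symm x) v)) = v := by
  have hinv := congrArg (fun L => L v)
    ((mdifferentiable_chart he).symm_comp_deriv (e.map_target hx))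
  have hbase : ∀ y, y = x → ∀ u : Coord m, (show Coord m from mfderiv (𝓡 m) (𝓡 m) e.symm y u)
      = (show Coord m from mfderiv (𝓡 m) (𝓡 m) e.symm x u) := by
    rintro _ rfl u
    rfl
  exact (hbase _ (e.right_inv hx) _).symm.trans hinv

theorem eq_zero_of_components_eq_zero (he : e ∈ IsManifold.maximalAtlas (𝓡 m) ∞ M) {p : M}
    (hp : p ∈ e.source) {v : TangentSpace (𝓡 m) p} (hv : components e p v = 0) : v = 0 := by
  obtain ⟨x, hx, rfl⟩ : ∃ x ∈ e.target, e.symm x = p := ⟨e p, e.map_source hp, e.left_inv hp⟩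
  rw [← mfderiv_symm_components he hx v, hv, WithLp.toLp_zero]
  exact map_zero (mfderiv (𝓡 m) (𝓡 m) e.symm x)

theorem mfderiv_symm_injective (he : e ∈ IsManifold.maximalAtlas (𝓡 m) ∞ M) {x : Coord m}
    (hx : x ∈ e.target) : Function.Injective (mfderiv (𝓡 m) (𝓡 m) e.symm x) := fun v w hvw => by
  have hcomp := congrArg (components e (e.symm x)) hvw
  exact WithLp.ofLp_injective 2 (((components_mfderiv_symm he hx v).symm.trans hcomp).trans
    (components_mfderiv_symm he hx w))

variable [IsManifold (𝓡 m) ∞ M]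

theorem contMDiffOn_mfderiv_symm (he : e ∈ IsManifold.maximalAtlas (𝓡 m) ∞ M)
    {s : Set Q} {B X : Q → Coord m} (hB : ContMDiffOn (𝓡 k) (𝓡 m) ∞ B s)
    (hX : ContMDiffOn (𝓡 k) (𝓡 m) ∞ X s) (hs : Set.MapsTo B s e.target) :
    ContMDiffOn (𝓡 k) (𝓡 m).tangent ∞
      (fun q => (⟨e.symm (B q), mfderiv (𝓡 m) (𝓡 m) e.symm (B q) (X q)⟩ :
        TangentBundle (𝓡 m) M)) s := by
  have : IsManifold (𝓡 m) 1 M := IsManifold.of_le (n := ∞) (by simp)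
  have hsymm := (contMDiffOn_symm_of_mem_maximalAtlas he).contMDiffOn_tangentMapWithin
    (m := ∞) (by simp) e.open_target.uniqueMDiffOn
  have hpair : ContMDiffOn (𝓡 k) (𝓡 m).tangent ∞
      (fun q => (⟨B q, X q⟩ : TangentBundle (𝓡 m) (Coord m))) s := by
    refine ContMDiff.comp_contMDiffOn (g := (tangentBundleModelSpaceHomeomorph (𝓡 m)).symm)
      (f := fun q => (B q, X q)) ?_ (hB.prodMk hX)
    convert! contMDiff_tangentBundleModelSpaceHomeomorph_symm (I := 𝓡 m)
    rw [chartedSpaceSelf_prod]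
    rfl
  refine (hsymm.comp hpair fun q hq => hs hq).congr fun q hq => ?_
  simp only [Function.comp_apply, tangentMapWithin]
  rw [mfderivWithin_of_isOpen e.open_target (hs hq)]

theorem contMDiffOn_mfderiv_chart (he : e ∈ IsManifold.maximalAtlas (𝓡 m) ∞ M)
    {s : Set Q} {Z : Q → TangentBundle (𝓡 m) M} (hZ : ContMDiffOn (𝓡 k) (𝓡 m).tangent ∞ Z s)
    (hs : ∀ q ∈ s, (Z q).1 ∈ e.source) :
    ContMDiffOn (𝓡 k) (𝓡 m) ∞
      (fun q => (show Coord m from mfderiv (𝓡 m) (𝓡 m) e (Z q).1 (Z q).2)) s := by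
  have : IsManifold (𝓡 m) 1 M := IsManifold.of_le (n := ∞) (by simp)
  have hchart := (contMDiffOn_of_mem_maximalAtlas he).contMDiffOn_tangentMapWithin
    (m := ∞) (by simp) e.open_source.uniqueMDiffOn
  have hsnd := (contMDiff_snd_tangentBundle_modelSpace (Coord m) (𝓡 m) (n := ∞)).comp_contMDiffOn
    (hchart.comp hZ hs)
  refine hsnd.congr fun q hq => ?_
  exact (congrArg (fun L => L (Z q).2) (mfderivWithin_of_isOpen (I := 𝓡 m) (I' := 𝓡 m) (f := e)
    e.open_source (hs q hq))).symm

variable {g : Bundle.ContMDiffRiemannianMetric (𝓡 m) ∞ (Coord m)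
  (fun p : M => TangentSpace (𝓡 m) p)}

theorem metricField_mfderiv_symm (x v w : Coord m) :
    metricField g (e.symm x) (mfderiv (𝓡 m) (𝓡 m) e.symm x v) (mfderiv (𝓡 m) (𝓡 m) e.symm x w)
      = bil (metricInChart (metricField g) e x) v w := by
  let D : Coord m →L[ℝ] TangentSpace (𝓡 m) (e.symm x) := mfderiv (𝓡 m) (𝓡 m) e.symm x
  have hsum (u : Coord m) : D u = ∑ i, u i • D (EuclideanSpace.single i 1) := by
    conv_lhs => rw [coord_eq_sum u]
    simp only [map_sum, map_smul]
  change g.inner (e.symm x) (D v) (D w) = _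
  rw [hsum v, hsum w, bil_apply]
  simp only [map_sum, map_smul, sum_apply, smul_apply, smul_eq_mul, Finset.mul_sum]
  rw [Finset.sum_comm]
  exact Finset.sum_congr rfl fun i _ => Finset.sum_congr rfl fun j _ => by
    rw [mul_left_comm, ← mul_assoc, mul_comm, ← mul_assoc]; rfl

theorem metricField_eq_bil (he : e ∈ IsManifold.maximalAtlas (𝓡 m) ∞ M) {p : M}
    (hp : p ∈ e.source) (v w : TangentSpace (𝓡 m) p) :
    metricField g p v w
      = bil (metricInChart (metricField g) e (e p)) (components e p v) (components e p w) := by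
  obtain ⟨x, hx, rfl⟩ : ∃ x ∈ e.target, e.symm x = p := ⟨e p, e.map_source hp, e.left_inv hp⟩
  rw [e.right_inv hx]
  have hbil := metricField_mfderiv_symm (g := g) (e := e) x
    (WithLp.toLp 2 (components e (e.symm x) v)) (WithLp.toLp 2 (components e (e.symm x) w))
  rwa [mfderiv_symm_components he hx, mfderiv_symm_components he hx] at hbil

theorem contDiffOn_metricInChart (he : e ∈ IsManifold.maximalAtlas (𝓡 m) ∞ M) (i j : Fin m) :
    ContDiffOn ℝ ∞ (fun x => metricInChart (metricField g) e x i j) e.target := by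
  have hcoord (i : Fin m) : ContMDiffOn (𝓡 m) (𝓡 m).tangent ∞
      (fun x => (⟨e.symm x, mfderiv (𝓡 m) (𝓡 m) e.symm x (EuclideanSpace.single i (1 : ℝ))⟩ :
        TangentBundle (𝓡 m) M)) e.target :=
    contMDiffOn_mfderiv_symm he contMDiffOn_id contMDiffOn_const fun _ hx => hx
  have hbundle : ContMDiffOn (𝓡 m) ((𝓡 m).prod 𝓘(ℝ)) ∞ (fun x =>
      Bundle.TotalSpace.mk' ℝ (E := Bundle.Trivial M ℝ) (e.symm x)
        (metricInChart (metricField g) e x i j)) e.target := by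
    apply ContMDiffOn.clm_bundle_apply₂ (F₁ := Coord m) (F₂ := Coord m)
    · exact g.contMDiff.comp_contMDiffOn (contMDiffOn_symm_of_mem_maximalAtlas he)
    · exact hcoord i
    · exact hcoord j
  exact contMDiffOn_iff_contDiffOn.1 fun x hx =>
    (Bundle.contMDiffWithinAt_totalSpace.1 (hbundle x hx)).2

theorem isMetricOn_metricInChart (he : e ∈ IsManifold.maximalAtlas (𝓡 m) ∞ M) :
    IsMetricOn (metricInChart (metricField g) e) e.target where
  isOpen := e.open_target
  smooth := contDiffOn_metricInChart he
  posDef x hx := by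
    refine posDef_of_bil_pos (Matrix.IsSymm.ext fun i j => g.symm _ _ _) fun v hv => ?_
    refine lt_of_lt_of_eq (g.pos _ _ fun h0 => hv ?_)
      (metricField_mfderiv_symm x (WithLp.toLp 2 v) (WithLp.toLp 2 v))
    exact WithLp.toLp_injective 2 (mfderiv_symm_injective he hx
      (h0.trans (map_zero (mfderiv (𝓡 m) (𝓡 m) e.symm x)).symm))

end Charts

/-! ### Maps between manifolds in charts -/

section ChartDomain

variable {m n : ℕ}
variable {M : Type*} [TopologicalSpace M] {N : Type*} [TopologicalSpace N]
variable {φ : M → N} {e : OpenPartialHomeomorph M (Coord m)}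
  {e' : OpenPartialHomeomorph N (Coord n)}

/-- The domain of `mapInCharts φ e e'`. -/
def chartDomain (φ : M → N) (e : OpenPartialHomeomorph M (Coord m))
    (e' : OpenPartialHomeomorph N (Coord n)) : Set (Coord m) :=
  e.target ∩ e.symm ⁻¹' (φ ⁻¹' e'.source)

theorem mem_chartDomain {p : M} (hp : p ∈ e.source) (hp' : φ p ∈ e'.source) :
    e p ∈ chartDomain φ e e' :=
  ⟨e.map_source hp, by simpa [e.left_inv hp] using hp'⟩

variable [ChartedSpace (Coord n) N]

/-- The vector field along `φ` whose components in the charts `e` and `e'` are `ν`; it is a right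
inverse of `fieldInCharts`. -/
def fieldOfComponents (φ : M → N) (e : OpenPartialHomeomorph M (Coord m))
    (e' : OpenPartialHomeomorph N (Coord n)) (ν : Coord m → Fin n → ℝ) (p : M) :
    TangentSpace (𝓡 n) (φ p) :=
  (show Coord n from mfderiv (𝓡 n) (𝓡 n) e'.symm (e' (φ p)) (WithLp.toLp 2 (ν (e p))))

theorem components_fieldOfComponents (he' : e' ∈ IsManifold.maximalAtlas (𝓡 n) ∞ N)
    (ν : Coord m → Fin n → ℝ) {p : M} (hp' : φ p ∈ e'.source) :
    components e' (φ p) (fieldOfComponents φ e e' ν p) = ν (e p) := by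
  have hinv := components_mfderiv_symm he' (e'.map_source hp') (WithLp.toLp 2 (ν (e p)))
  rw [e'.left_inv hp'] at hinv
  exact hinv

end ChartDomain

section Maps

variable {m n : ℕ}
variable {M : Type*} [TopologicalSpace M] [ChartedSpace (Coord m) M]
variable {N : Type*} [TopologicalSpace N] [ChartedSpace (Coord n) N]
variable {e : OpenPartialHomeomorph M (Coord m)} {e' : OpenPartialHomeomorph N (Coord n)}
variable {φ : M → N} {x : Coord m}

theorem isSmoothMapOn_mapInCharts (he : e ∈ IsManifold.maximalAtlas (𝓡 m) ∞ M)
    (he' : e' ∈ IsManifold.maximalAtlas (𝓡 n) ∞ N) (hφ : ContMDiff (𝓡 m) (𝓡 n) ∞ φ) :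
    IsSmoothMapOn (mapInCharts φ e e') (chartDomain φ e e') e'.target where
  isOpen := e.isOpen_inter_preimage_symm (e'.open_source.preimage hφ.continuous)
  smooth := contMDiffOn_iff_contDiffOn.1 ((contMDiffOn_of_mem_maximalAtlas he').comp
    (hφ.comp_contMDiffOn ((contMDiffOn_symm_of_mem_maximalAtlas he).mono fun _ hx => hx.1))
    fun _ hx => hx.2)
  mapsTo _ hx := e'.map_source hx.2

theorem components_mfderiv (he : e ∈ IsManifold.maximalAtlas (𝓡 m) ∞ M)
    (he' : e' ∈ IsManifold.maximalAtlas (𝓡 n) ∞ N) (hφ : ContMDiff (𝓡 m) (𝓡 n) ∞ φ)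
    (hx : x ∈ chartDomain φ e e') (w : Coord m) :
    components e' (φ (e.symm x))
        (mfderiv (𝓡 m) (𝓡 n) φ (e.symm x) (mfderiv (𝓡 m) (𝓡 m) e.symm x w))
      = fderiv ℝ (mapInCharts φ e e') x w := by
  have he_symm := (mdifferentiable_chart he).mdifferentiableAt_symm hx.1
  have hφ_at : MDifferentiableAt (𝓡 m) (𝓡 n) φ (e.symm x) := hφ.mdifferentiableAt (by simp)
  have he'_at := (mdifferentiable_chart he').mdifferentiableAt hx.2
  have houter := mfderiv_comp_apply x (g := e') (f := φ ∘ e.symm) he'_at (hφ_at.comp x he_symm) w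
  have hinner := mfderiv_comp_apply x hφ_at he_symm w
  rw [← mfderiv_eq_fderiv]
  exact congrArg (fun (u : Coord n) a => u a)
    (houter.trans (congrArg (mfderiv (𝓡 n) (𝓡 n) e' (φ (e.symm x))) hinner)).symm

theorem components_mfderiv_eq_sum (he : e ∈ IsManifold.maximalAtlas (𝓡 m) ∞ M)
    (he' : e' ∈ IsManifold.maximalAtlas (𝓡 n) ∞ N) (hφ : ContMDiff (𝓡 m) (𝓡 n) ∞ φ)
    (hx : x ∈ chartDomain φ e e') (w : Coord m) :
    components e' (φ (e.symm x))
        (mfderiv (𝓡 m) (𝓡 n) φ (e.symm x) (mfderiv (𝓡 m) (𝓡 m) e.symm x w))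
      = ∑ i, w i • dMap (mapInCharts φ e e') i x := by
  have hd := (isSmoothMapOn_mapInCharts he he' hφ).differentiableAt hx
  funext a
  rw [components_mfderiv he he' hφ hx]
  conv_lhs => rw [coord_eq_sum w]
  simp [dMap_eq_fderiv_apply hd]

theorem components_mfderiv_single (he : e ∈ IsManifold.maximalAtlas (𝓡 m) ∞ M)
    (he' : e' ∈ IsManifold.maximalAtlas (𝓡 n) ∞ N) (hφ : ContMDiff (𝓡 m) (𝓡 n) ∞ φ)
    (hx : x ∈ chartDomain φ e e') (i : Fin m) :
    components e' (φ (e.symm x)) (mfderiv (𝓡 m) (𝓡 n) φ (e.symm x)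
        (mfderiv (𝓡 m) (𝓡 m) e.symm x (EuclideanSpace.single i (1 : ℝ))))
      = dMap (mapInCharts φ e e') i x := by
  rw [components_mfderiv_eq_sum he he' hφ hx]
  simp

theorem linearIndependent_dMap (he : e ∈ IsManifold.maximalAtlas (𝓡 m) ∞ M)
    (he' : e' ∈ IsManifold.maximalAtlas (𝓡 n) ∞ N) (hφ : ContMDiff (𝓡 m) (𝓡 n) ∞ φ)
    (himm : ∀ p, Function.Injective (mfderiv (𝓡 m) (𝓡 n) φ p)) (hx : x ∈ chartDomain φ e e') :
    LinearIndependent ℝ fun i => dMap (mapInCharts φ e e') i x := by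
  refine Fintype.linearIndependent_iff.2 fun v hv => congr_fun ?_
  have hcomp := (components_mfderiv_eq_sum he he' hφ hx (WithLp.toLp 2 v)).trans hv
  have hdφ := eq_zero_of_components_eq_zero he' hx.2 hcomp
  have hde := himm _ (hdφ.trans (map_zero _).symm)
  exact WithLp.toLp_injective 2
    (mfderiv_symm_injective he hx.1 (hde.trans (map_zero (mfderiv (𝓡 m) (𝓡 m) e.symm x)).symm))

variable [IsManifold (𝓡 n) ∞ N]
  {h : Bundle.ContMDiffRiemannianMetric (𝓡 n) ∞ (Coord n) (fun q : N => TangentSpace (𝓡 n) q)}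

theorem isIsometricImmersionOn_mapInCharts (he : e ∈ IsManifold.maximalAtlas (𝓡 m) ∞ M)
    (he' : e' ∈ IsManifold.maximalAtlas (𝓡 n) ∞ N) (hφ : ContMDiff (𝓡 m) (𝓡 n) ∞ φ)
    (himm : ∀ p, Function.Injective (mfderiv (𝓡 m) (𝓡 n) φ p)) :
    IsIsometricImmersionOn (metricInChart (pullbackMetric m (metricField h) φ) e)
      (metricInChart (metricField h) e') (mapInCharts φ e e') (chartDomain φ e e') e'.target := by
  refine .of_linearIndependent (isMetricOn_metricInChart he')
    (isSmoothMapOn_mapInCharts he he' hφ) (fun x => linearIndependent_dMap he he' hφ himm)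
    fun x hx i j => ?_
  rw [← components_mfderiv_single he he' hφ hx, ← components_mfderiv_single he he' hφ hx]
  exact (metricField_eq_bil he' hx.2 _ _).symm

theorem isHypersurfaceOn_fieldInCharts (he : e ∈ IsManifold.maximalAtlas (𝓡 m) ∞ M)
    (he' : e' ∈ IsManifold.maximalAtlas (𝓡 n) ∞ N) (hφ : ContMDiff (𝓡 m) (𝓡 n) ∞ φ)
    (himm : ∀ p, Function.Injective (mfderiv (𝓡 m) (𝓡 n) φ p)) (hn : n = m + 1) {U : Set M}
    (hU : IsOpen U) {ξ : ∀ p : M, TangentSpace (𝓡 n) (φ p)}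
    (hξ : IsUnitNormalOn m (metricField h) φ ξ U) :
    IsHypersurfaceOn (metricInChart (pullbackMetric m (metricField h) φ) e)
      (metricInChart (metricField h) e') (mapInCharts φ e e') (fieldInCharts φ ξ e e')
      (chartDomain φ e e' ∩ (e.target ∩ e.symm ⁻¹' U)) e'.target where
  toIsIsometricImmersionOn := by
    have himm := isIsometricImmersionOn_mapInCharts (h := h) he he' hφ himm
    exact himm.mono (himm.map.isOpen.inter (e.isOpen_inter_preimage_symm hU)) Set.inter_subset_left
  codim := hn
  smooth := by
    have hfield : ContMDiffOn (𝓡 m) (𝓡 n).tangent ∞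
        (fun x => (⟨φ (e.symm x), ξ (e.symm x)⟩ : TangentBundle (𝓡 n) N))
        (chartDomain φ e e' ∩ (e.target ∩ e.symm ⁻¹' U)) :=
      hξ.smooth.comp ((contMDiffOn_symm_of_mem_maximalAtlas he).mono fun _ hx => hx.1.1)
        fun _ hx => hx.2.2
    exact contDiffOn_pi.2 (contDiffOn_apply
      (contMDiffOn_iff_contDiffOn.1 (contMDiffOn_mfderiv_chart he' hfield fun x hx => hx.1.2)))
  unit x hx := (metricField_eq_bil he' hx.1.2 _ _).symm.trans (hξ.unit _ hx.2.2)
  normal x hx i := by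
    rw [← components_mfderiv_single he he' hφ hx.1]
    exact (metricField_eq_bil he' hx.1.2 _ _).symm.trans (hξ.normal _ hx.2.2 _)

theorem contMDiffOn_fieldOfComponents (he : e ∈ IsManifold.maximalAtlas (𝓡 m) ∞ M)
    (he' : e' ∈ IsManifold.maximalAtlas (𝓡 n) ∞ N) (hφ : ContMDiff (𝓡 m) (𝓡 n) ∞ φ)
    {s : Set (Coord m)} (hs : s ⊆ chartDomain φ e e') {ν : Coord m → Fin n → ℝ}
    (hν : ContDiffOn ℝ ∞ ν s) :
    ContMDiffOn (𝓡 m) (𝓡 n).tangent ∞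
      (fun p => (⟨φ p, fieldOfComponents φ e e' ν p⟩ : TangentBundle (𝓡 n) N))
      (e.source ∩ e ⁻¹' s) := by
  have hsource : Set.MapsTo φ (e.source ∩ e ⁻¹' s) e'.source := fun p hp => by
    simpa [e.left_inv hp.1] using (hs hp.2).2
  have hbase : ContMDiffOn (𝓡 m) (𝓡 n) ∞ (fun p => e' (φ p)) (e.source ∩ e ⁻¹' s) :=
    (contMDiffOn_of_mem_maximalAtlas he').comp hφ.contMDiffOn hsource
  have hcomp : ContMDiffOn (𝓡 m) (𝓡 n) ∞ (fun p => (WithLp.toLp 2 (ν (e p)) : Coord n))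
      (e.source ∩ e ⁻¹' s) :=
    (contMDiffOn_iff_contDiffOn.2 (contDiffOn_piLp' (p := 2) (contDiffOn_pi.1 hν))).comp
      ((contMDiffOn_of_mem_maximalAtlas he).mono Set.inter_subset_left) fun _ hp => hp.2
  have hmk {y z : N} (hyz : y = z) (v : Coord n) :
      (⟨y, v⟩ : TangentBundle (𝓡 n) N) = ⟨z, v⟩ := by
    subst hyz
    rfl
  exact (contMDiffOn_mfderiv_symm he' hbase hcomp fun p hp => e'.map_source (hsource hp)).congr
    fun p hp => hmk (e'.left_inv (hsource hp)).symm _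

theorem isUnitNormalOn_fieldOfComponents (he : e ∈ IsManifold.maximalAtlas (𝓡 m) ∞ M)
    (he' : e' ∈ IsManifold.maximalAtlas (𝓡 n) ∞ N) (hφ : ContMDiff (𝓡 m) (𝓡 n) ∞ φ)
    {s : Set (Coord m)} (hs : s ⊆ chartDomain φ e e') {ν : Coord m → Fin n → ℝ}
    {G : Coord m → Matrix (Fin m) (Fin m) ℝ}
    (hν : IsHypersurfaceOn G (metricInChart (metricField h) e') (mapInCharts φ e e') ν s
      e'.target) :
    IsUnitNormalOn m (metricField h) φ (fieldOfComponents φ e e' ν) (e.source ∩ e ⁻¹' s) := by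
  have hsource : ∀ p ∈ e.source ∩ e ⁻¹' s, φ p ∈ e'.source := fun p hp => by
    simpa [e.left_inv hp.1] using (hs hp.2).2
  have hmap : ∀ p ∈ e.source, e' (φ p) = mapInCharts φ e e' (e p) := fun p hp => by
    rw [mapInCharts, e.left_inv hp]
  refine ⟨contMDiffOn_fieldOfComponents he he' hφ hs hν.smooth, fun p hp => ?_, fun p hp v => ?_⟩
  · rw [metricField_eq_bil he' (hsource p hp), components_fieldOfComponents he' ν (hsource p hp),
      hmap p hp.1]
    exact hν.unit _ hp.2
  · rw [metricField_eq_bil he' (hsource p hp), components_fieldOfComponents he' ν (hsource p hp),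
      hmap p hp.1]
    obtain ⟨x, hx, rfl⟩ : ∃ x ∈ e.target, e.symm x = p :=
      ⟨e p, e.map_source hp.1, e.left_inv hp.1⟩
    have hxs : x ∈ s := by simpa [e.right_inv hx] using hp.2
    rw [← mfderiv_symm_components he hx v, components_mfderiv_eq_sum he he' hφ (hs hxs),
      e.right_inv hx]
    simp [map_sum, hν.normal x hxs]

theorem exists_isUnitNormalOn [IsManifold (𝓡 m) ∞ M] (hφ : ContMDiff (𝓡 m) (𝓡 n) ∞ φ)
    (himm : ∀ p, Function.Injective (mfderiv (𝓡 m) (𝓡 n) φ p)) (hn : n = m + 1) (p : M) :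
    ∃ (U : Set M) (ξ : ∀ p : M, TangentSpace (𝓡 n) (φ p)), IsOpen U ∧ p ∈ U ∧
      IsUnitNormalOn m (metricField h) φ ξ U := by
  have he := IsManifold.chart_mem_maximalAtlas (I := 𝓡 m) (n := ∞) p
  have he' := IsManifold.chart_mem_maximalAtlas (I := 𝓡 n) (n := ∞) (φ p)
  have hp := mem_chart_source (Coord m) p
  obtain ⟨s, hs, ν, hps, hν⟩ := (isIsometricImmersionOn_mapInCharts (h := h) he he' hφ
    himm).exists_isHypersurfaceOn hn (mem_chartDomain hp (mem_chart_source (Coord n) (φ p)))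
  exact ⟨_, _, (chartAt (Coord m) p).isOpen_inter_preimage hν.map.isOpen, ⟨hp, hps⟩,
    isUnitNormalOn_fieldOfComponents he he' hφ hs hν⟩

end Maps

section ConformalMaps

variable {m n : ℕ}
variable {M : Type*} [TopologicalSpace M] [ChartedSpace (Coord m) M] [IsManifold (𝓡 m) ∞ M]
variable {N : Type*} [TopologicalSpace N] [ChartedSpace (Coord n) N] [IsManifold (𝓡 n) ∞ N]
variable {e : OpenPartialHomeomorph M (Coord m)} {e' : OpenPartialHomeomorph N (Coord n)}
variable {φ : M → N} {f : M → ℝ}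
  {g : Bundle.ContMDiffRiemannianMetric (𝓡 m) ∞ (Coord m) (fun p : M => TangentSpace (𝓡 m) p)}
  {h : Bundle.ContMDiffRiemannianMetric (𝓡 n) ∞ (Coord n) (fun q : N => TangentSpace (𝓡 n) q)}

theorem conformalFactor_ne_zero [NeZero m]
    (himm : ∀ p, Function.Injective (mfderiv (𝓡 m) (𝓡 n) φ p))
    (hconf : ∀ p v w, pullbackMetric m (metricField h) φ p v w = f p * metricField g p v w)
    (p : M) : f p ≠ 0 := fun hf => by
  let v : TangentSpace (𝓡 m) p := (show Coord m from EuclideanSpace.single 0 (1 : ℝ))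
  have hv : v ≠ 0 := (PiLp.single_eq_zero_iff 2 _).not.2 one_ne_zero
  have hpos := h.pos (φ p) (mfderiv (𝓡 m) (𝓡 n) φ p v)
    fun h0 => hv (himm p (h0.trans (map_zero _).symm))
  exact hpos.ne' ((hconf p v v).trans (by rw [hf, zero_mul]))

theorem contDiffOn_conformalFactor [NeZero m] (he : e ∈ IsManifold.maximalAtlas (𝓡 m) ∞ M)
    (he' : e' ∈ IsManifold.maximalAtlas (𝓡 n) ∞ N) (hφ : ContMDiff (𝓡 m) (𝓡 n) ∞ φ)
    (himm : ∀ p, Function.Injective (mfderiv (𝓡 m) (𝓡 n) φ p))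
    (hconf : ∀ p v w, pullbackMetric m (metricField h) φ p v w = f p * metricField g p v w) :
    ContDiffOn ℝ ∞ (f ∘ e.symm) (chartDomain φ e e') := by
  have himm' := isIsometricImmersionOn_mapInCharts (h := h) he he' hφ himm
  have hG := (isMetricOn_metricInChart (g := g) he).mono himm'.map.isOpen fun _ hx => hx.1
  have hne : ∀ x ∈ chartDomain φ e e', metricInChart (metricField g) e x 0 0 ≠ 0 :=
    fun x hx => (hG.posDef x hx).diag_pos.ne'
  exact ((himm'.source.smooth 0 0).div (hG.smooth 0 0) hne).congr fun x hx =>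
    (eq_div_iff (hne x hx)).2 (hconf _ _ _).symm

end ConformalMaps

section Surfaces

variable {n : ℕ}
variable {M : Type*} [TopologicalSpace M] [ChartedSpace (Coord 2) M] [IsManifold (𝓡 2) ∞ M]
variable {N : Type*} [TopologicalSpace N] [ChartedSpace (Coord n) N] [IsManifold (𝓡 n) ∞ N]
variable {e : OpenPartialHomeomorph M (Coord 2)} {e' : OpenPartialHomeomorph N (Coord n)}
variable {φ : M → N} {f : M → ℝ}
  {g : Bundle.ContMDiffRiemannianMetric (𝓡 2) ∞ (Coord 2) (fun p : M => TangentSpace (𝓡 2) p)}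
  {h : Bundle.ContMDiffRiemannianMetric (𝓡 n) ∞ (Coord n) (fun q : N => TangentSpace (𝓡 n) q)}

theorem isBiharmonic_iff_isFBiharmonic (hφ : ContMDiff (𝓡 2) (𝓡 n) ∞ φ)
    (himm : ∀ p, Function.Injective (mfderiv (𝓡 2) (𝓡 n) φ p))
    (hconf : ∀ p v w, pullbackMetric 2 (metricField h) φ p v w = f p * metricField g p v w) :
    IsBiharmonic (metricField g) (metricField h) φ ↔
      IsFBiharmonic (pullbackMetric 2 (metricField h) φ) (metricField h) f φ := by
  have hf := conformalFactor_ne_zero himm hconf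
  refine forall₂_congr fun e he => forall₂_congr fun e' he' => forall₃_congr fun p hp hp' =>
    forall_congr' fun a => ?_
  have himm' := isIsometricImmersionOn_mapInCharts (h := h) he he' hφ himm
  have hG := (isMetricOn_metricInChart (g := g) he).mono himm'.map.isOpen fun _ hx => hx.1
  rw [bitension_conformal hG himm'.source himm'.metric himm'.map (mem_chartDomain hp hp')
    (contDiffOn_conformalFactor he he' hφ himm hconf) (fun x _ => hf (e.symm x))
    fun x _ => Matrix.ext fun i j => hconf _ _ _, Pi.smul_apply, smul_eq_mul, mul_eq_zero,
    or_iff_right (show (f ∘ e.symm) (e p) ≠ 0 from hf _)]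

end Surfaces

section SurfacesInDimThree

variable {M : Type*} [TopologicalSpace M] [ChartedSpace (Coord 2) M] [IsManifold (𝓡 2) ∞ M]
variable {N : Type*} [TopologicalSpace N] [ChartedSpace (Coord 3) N] [IsManifold (𝓡 3) ∞ N]
variable {e : OpenPartialHomeomorph M (Coord 2)} {e' : OpenPartialHomeomorph N (Coord 3)}
variable {φ : M → N} {f : M → ℝ}
  {g : Bundle.ContMDiffRiemannianMetric (𝓡 2) ∞ (Coord 2) (fun p : M => TangentSpace (𝓡 2) p)}
  {h : Bundle.ContMDiffRiemannianMetric (𝓡 3) ∞ (Coord 3) (fun q : N => TangentSpace (𝓡 3) q)}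

theorem fBitension_eq_zero_iff_systemAt (he : e ∈ IsManifold.maximalAtlas (𝓡 2) ∞ M)
    (he' : e' ∈ IsManifold.maximalAtlas (𝓡 3) ∞ N) (hφ : ContMDiff (𝓡 2) (𝓡 3) ∞ φ)
    (himm : ∀ p, Function.Injective (mfderiv (𝓡 2) (𝓡 3) φ p))
    (hconf : ∀ p v w, pullbackMetric 2 (metricField h) φ p v w = f p * metricField g p v w)
    {U : Set M} (hU : IsOpen U) {ξ : ∀ p : M, TangentSpace (𝓡 3) (φ p)}
    (hξ : IsUnitNormalOn 2 (metricField h) φ ξ U) {p : M} (hp : p ∈ e.source ∩ U)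
    (hp' : φ p ∈ e'.source) :
    (∀ a, fBitension (metricInChart (pullbackMetric 2 (metricField h) φ) e)
        (metricInChart (metricField h) e') (f ∘ e.symm) (mapInCharts φ e e') (e p) a = 0) ↔
      SystemAt (metricInChart (pullbackMetric 2 (metricField h) φ) e)
        (metricInChart (metricField h) e') (f ∘ e.symm) (mapInCharts φ e e')
        (fieldInCharts φ ξ e e') (e p) := by
  have hS := isHypersurfaceOn_fieldInCharts he he' hφ himm rfl hU hξ
  have hx : e p ∈ chartDomain φ e e' ∩ (e.target ∩ e.symm ⁻¹' U) :=
    ⟨mem_chartDomain hp.1 hp', e.map_source hp.1, by simpa [e.left_inv hp.1] using hp.2⟩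
  exact funext_iff.symm.trans (hS.fBitension_eq_zero_iff hx
    ((contDiffOn_conformalFactor he he' hφ himm hconf).mono Set.inter_subset_left))

theorem systemOn_of_isFBiharmonic (hφ : ContMDiff (𝓡 2) (𝓡 3) ∞ φ)
    (himm : ∀ p, Function.Injective (mfderiv (𝓡 2) (𝓡 3) φ p))
    (hconf : ∀ p v w, pullbackMetric 2 (metricField h) φ p v w = f p * metricField g p v w)
    (hf : IsFBiharmonic (pullbackMetric 2 (metricField h) φ) (metricField h) f φ)
    {U : Set M} (hU : IsOpen U) {ξ : ∀ p : M, TangentSpace (𝓡 3) (φ p)}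
    (hξ : IsUnitNormalOn 2 (metricField h) φ ξ U) :
    SystemOn (pullbackMetric 2 (metricField h) φ) (metricField h) f φ ξ U :=
  fun e he e' he' p hp hp' =>
    (fBitension_eq_zero_iff_systemAt he he' hφ himm hconf hU hξ hp hp').1
      (hf e he e' he' p hp.1 hp')

theorem isFBiharmonic_of_locally_systemOn (hφ : ContMDiff (𝓡 2) (𝓡 3) ∞ φ)
    (himm : ∀ p, Function.Injective (mfderiv (𝓡 2) (𝓡 3) φ p))
    (hconf : ∀ p v w, pullbackMetric 2 (metricField h) φ p v w = f p * metricField g p v w)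
    (hloc : ∀ p, ∃ U ξ, IsOpen U ∧ p ∈ U ∧ IsUnitNormalOn 2 (metricField h) φ ξ U ∧
      SystemOn (pullbackMetric 2 (metricField h) φ) (metricField h) f φ ξ U) :
    IsFBiharmonic (pullbackMetric 2 (metricField h) φ) (metricField h) f φ := by
  intro e he e' he' p hp hp'
  obtain ⟨U, ξ, hU, hpU, hξ, hsys⟩ := hloc p
  exact (fBitension_eq_zero_iff_systemAt he he' hφ himm hconf hU hξ ⟨hp, hpU⟩ hp').2
    (hsys e he e' he' p ⟨hp, hpU⟩ hp')

end SurfacesInDimThree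

end BiharmonicSurface

end

theorem theorem4p2
    {M : Type*} [TopologicalSpace M] [ChartedSpace (EuclideanSpace ℝ (Fin 2)) M]
    [IsManifold (𝓡 2) ∞ M]
    {N : Type*} [TopologicalSpace N] [ChartedSpace (EuclideanSpace ℝ (Fin 3)) N]
    [IsManifold (𝓡 3) ∞ N]
    (gbar : Bundle.ContMDiffRiemannianMetric (𝓡 2) ∞ (EuclideanSpace ℝ (Fin 2))
      (fun p : M => TangentSpace (𝓡 2) p))
    (h : Bundle.ContMDiffRiemannianMetric (𝓡 3) ∞ (EuclideanSpace ℝ (Fin 3))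
      (fun q : N => TangentSpace (𝓡 3) q))
    (φ : M → N) (hφ : ContMDiff (𝓡 2) (𝓡 3) ∞ φ)
    (hφ_imm : ∀ p, Function.Injective (mfderiv (𝓡 2) (𝓡 3) φ p))
    (lam : M → ℝ)
    (hconf : ∀ (p : M) (v w : TangentSpace (𝓡 2) p),
      h.inner (φ p) (mfderiv (𝓡 2) (𝓡 3) φ p v) (mfderiv (𝓡 2) (𝓡 3) φ p w)
        = lam p ^ 2 * gbar.inner p v w) :
    -- `φ` is biharmonic iff the surface (with the induced metric) is `lam²`-biharmonic
    (BiharmonicSurface.IsBiharmonic (BiharmonicSurface.metricField gbar)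
        (BiharmonicSurface.metricField h) φ ↔
      BiharmonicSurface.IsFBiharmonic (BiharmonicSurface.pullbackMetric 2 (BiharmonicSurface.metricField h) φ)
        (BiharmonicSurface.metricField h)
        (fun p => lam p ^ 2) φ) ∧
    -- this is characterized by the system, for all local unit normal fields
    (BiharmonicSurface.IsFBiharmonic (BiharmonicSurface.pullbackMetric 2 (BiharmonicSurface.metricField h) φ)
        (BiharmonicSurface.metricField h)
        (fun p => lam p ^ 2) φ ↔
      ∀ (U : Set M) (ξ : ∀ p : M, TangentSpace (𝓡 3) (φ p)), IsOpen U →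
        BiharmonicSurface.IsUnitNormalOn 2 (BiharmonicSurface.metricField h) φ ξ U →
          BiharmonicSurface.SystemOn (BiharmonicSurface.pullbackMetric 2 (BiharmonicSurface.metricField h) φ)
        (BiharmonicSurface.metricField h)
            (fun p => lam p ^ 2) φ ξ U) ∧
    -- and, if there is one, for any single global unit normal field
    ∀ ξ : ∀ p : M, TangentSpace (𝓡 3) (φ p),
      BiharmonicSurface.IsUnitNormalOn 2 (BiharmonicSurface.metricField h) φ ξ Set.univ →
        (BiharmonicSurface.IsFBiharmonic (BiharmonicSurface.pullbackMetric 2 (BiharmonicSurface.metricField h) φ)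
        (BiharmonicSurface.metricField h)
            (fun p => lam p ^ 2) φ ↔
          BiharmonicSurface.SystemOn (BiharmonicSurface.pullbackMetric 2 (BiharmonicSurface.metricField h) φ)
        (BiharmonicSurface.metricField h)
            (fun p => lam p ^ 2) φ ξ Set.univ) := by
  have of_locally := BiharmonicSurface.isFBiharmonic_of_locally_systemOn hφ hφ_imm hconf
  refine ⟨BiharmonicSurface.isBiharmonic_iff_isFBiharmonic hφ hφ_imm hconf,
    ⟨fun hf U ξ hU hξ => BiharmonicSurface.systemOn_of_isFBiharmonic hφ hφ_imm hconf hf hU hξ,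
      fun hsys => of_locally fun p => ?_⟩,
    fun ξ hξ =>
      ⟨fun hf => BiharmonicSurface.systemOn_of_isFBiharmonic hφ hφ_imm hconf hf isOpen_univ hξ,
        fun hsys => of_locally fun p => ⟨Set.univ, ξ, isOpen_univ, Set.mem_univ p, hξ, hsys⟩⟩⟩
  obtain ⟨U, ξ, hU, hpU, hξ⟩ := BiharmonicSurface.exists_isUnitNormalOn (h := h) hφ hφ_imm rfl p
  exact ⟨U, ξ, hU, hpU, hξ, hsys U ξ hU hξ⟩
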